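/- **The calculus.** Let $\mathbf{mtt}$ be Maietti's minimal type theory (the intensional level of the minimalist foundation). It is a dependent type theory with four kinds of types: collections ($col$), sets ($set$), propositions ($prop$) and small propositions ($prop_s$). Sets and propositions are collections, and small propositions are both sets and propositions. Collections are closed under strong indexed sums $\Sigma$, and include the collection of codes of small propositions (with decoding $\tau$) and the functions from a set to it. Sets include the empty set and the singleton set and are closed under $\Sigma$, dependent products $\Pi$, lists and disjoint sums. Propositions are closed under $\bot,\vee,\wedge,\to$, quantifiers $\exists,\forall$ over collections and propositional equality $\mathsf{Id}(A,a,b)$ on collections; small propositions are closed under the same constructors with quantification and equality restricted to sets. All propositions have proof-terms and eliminate only towards propositions. Definitional equality contains the $\beta$-rules and is preserved by substitution in types and in terms (no $\xi$-rule). **The doctrines.** Let $\mathcal{CM}$ be the category whose objects are the closed collections of $\mathbf{mtt}$ and whose arrows $A\to B$ are the terms $t\in B\ [x\in A]$ modulo $t\sim t'$ iff $p\in\mathsf{Id}(B,t,t')\ [x\in A]$ is derivable for some $p$; composition is substitution. Let $\mathcal{SM}$ be its full subcategory on the closed sets. Let $F^{\mathbf{mtt}}(A)$, for $A$ in $\mathcal{CM}$,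 be the set of propositions $\phi\ prop\ [x\in A]$ modulo equiprovability, with $[\phi]\le[\psi]$ iff $r\in\psi\ [x\in A,w\in\phi]$ is derivable for some $r$; let $G^{\mathbf{mtt}}(A)$, for $A$ in $\mathcal{SM}$, be defined in the same way from the small propositions $\phi\ prop_s\ [x\in A]$. Both are functors to inf-semilattices with top element, arrows acting by substitution. **Terminology.** Let $P:\mathcal C^{op}\to\mathbf{InfSL}$ be a functor to inf-semilattices with top element, where $\mathcal C$ has finite products, and write $P_f$ for its action on an arrow $f$. - $P$ is *elementary* if for all $A,C$ the map $P_{\mathrm{id}_C\times\Delta_A}$ has a left adjoint $E$ satisfying $E(P_{\mathrm{id}_C\times\Delta_A}(\alpha)\wedge\beta)=\alpha\wedge E(\beta)$. Then each $P_{\Delta_A}$ has a left adjoint, whose value at $\top$ is denoted $\delta_A$. - $P$ is *existential* if for every product projection $pr$ the map $P_{pr}$ has a left adjoint $E_{pr}$ with $E_{pr}(P_{pr}(\alpha)\wedge\beta)=\alpha\wedge E_{pr}(\beta)$, and $E_{pr'}P_{f'}=P_fE_{pr}$ for every pullback of a projection $pr$ along an arrow $f$, with opposite sides $pr'$ and $f'$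 (Beck–Chevalley condition). - $P$ is *implicational* if every $\alpha\wedge-:P(A)\to P(A)$ has a right adjoint. - $P$ is *universal* if every $P_{pr}$, for $pr$ a projection, has a right adjoint $U_{pr}$, and $P_fU_{pr}=U_{pr'}P_{f'}$ for the same pullbacks. - A *weak comprehension* of $\alpha\in P(A)$ is an arrow $c:X\to A$ with $\top\le P_c(\alpha)$ through which every $g:Y\to A$ with $\top\le P_g(\alpha)$ factors (not necessarily uniquely). It is *full* if $\top\le P_c(\beta)$ implies $\alpha\le\beta$. It is *stable* if for every $f:A'\to A$ there is a weak comprehension $X'\to A'$ of $P_f(\alpha)$ that is part of a weak pullback of $c$ along $f$. - $P$ has *full weak comprehensions* if every $\alpha\in P(A)$, for every $A$, has a full weak comprehension. $P$ has *comprehensive weak equalizers* if each diagonal $\Delta_A$ is a stable weak comprehension of $\delta_A$. - $\mathcal C$ is *weakly cartesian closed* if for all $A,B$ there are an object $W$ and an arrow $w:W\times A\to B$ such that every $f:X\times A\to B$ is of the form $w\circ(f'\times\mathrm{id}_A)$ for some $f':X\to W$. **Proposition.** The categories $\mathcal{CM}$ and $\mathcal{SM}$ have finite products. The doctrines $F^{\mathbf{mtt}}:\mathcal{CM}^{op}\to\mathbf{InfSL}$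 and $G^{\mathbf{mtt}}:\mathcal{SM}^{op}\to\mathbf{InfSL}$ are elementary, existential, implicational and universal, and have full weak comprehensions and comprehensive weak equalizers. Moreover the base category $\mathcal{SM}$ of $G^{\mathbf{mtt}}$ is weakly cartesian closed. -/

import Mathlib

open CategoryTheory CategoryTheory.Limits Opposite

/-! ## Doctrines -/

namespace Doctrine

universe w v u

/-- The action `P_f : P(B) → P(A)` of a functor `P : Cᵒᵖ ⥤ InfSL` on an arrow `f : A ⟶ B`.
`SemilatInfCat` is the category of inf-semilattices with top element and of maps that preserve
finite infs; `P` is a primary doctrine when `C` has finite products. -/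
def pull {C : Type u} [Category.{v} C] (P : Cᵒᵖ ⥤ SemilatInfCat.{w}) {A B : C} (f : A ⟶ B)
    (b : P.obj (op B)) : P.obj (op A) :=
  ConcreteCategory.hom (P.map f.op) b

/-- `pr : X ⟶ A` is one of the two projections of some binary product. -/
def IsProjection {C : Type u} [Category.{v} C] {X A : C} (pr : X ⟶ A) : Prop :=
  ∃ (B : C) (q : X ⟶ B), Nonempty (IsLimit (BinaryFan.mk pr q))

/-- Elementary doctrine: left adjoints along `id_C × Δ_A`, with Frobenius reciprocity. -/
def IsElementary {C : Type u} [Category.{v} C] [HasFiniteProducts C]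
    (P : Cᵒᵖ ⥤ SemilatInfCat.{w}) : Prop :=
  ∀ K A : C, ∃ E : P.obj (op (K ⨯ A)) → P.obj (op (K ⨯ (A ⨯ A))),
    GaloisConnection E (pull P (prod.map (𝟙 K) (diag A))) ∧
    ∀ (α : P.obj (op (K ⨯ (A ⨯ A)))) (β : P.obj (op (K ⨯ A))),
      E (pull P (prod.map (𝟙 K) (diag A)) α ⊓ β) = α ⊓ E β

/-- Existential doctrine: left adjoints along projections, with Frobenius reciprocity and the
Beck-Chevalley condition. -/
def IsExistential {C : Type u} [Category.{v} C] (P : Cᵒᵖ ⥤ SemilatInfCat.{w}) : Prop :=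
  (∀ {X A : C} (pr : X ⟶ A), IsProjection pr →
    ∃ E : P.obj (op X) → P.obj (op A), GaloisConnection E (pull P pr) ∧
      ∀ (α : P.obj (op A)) (β : P.obj (op X)), E (pull P pr α ⊓ β) = α ⊓ E β) ∧
  (∀ {X' A' X A : C} (pr' : X' ⟶ A') (f' : X' ⟶ X) (f : A' ⟶ A) (pr : X ⟶ A),
    IsProjection pr → IsPullback pr' f' f pr →
    ∀ (E : P.obj (op X) → P.obj (op A)) (E' : P.obj (op X') → P.obj (op A')),
      GaloisConnection E (pull P pr) → GaloisConnection E' (pull P pr') →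
      ∀ β : P.obj (op X), E' (pull P f' β) = pull P f (E β))

/-- Implicational doctrine: each `α ⊓ -` has a right adjoint. -/
def IsImplicational {C : Type u} [Category.{v} C] (P : Cᵒᵖ ⥤ SemilatInfCat.{w}) : Prop :=
  ∀ (A : C) (α : P.obj (op A)), ∃ I : P.obj (op A) → P.obj (op A),
    GaloisConnection (fun γ => α ⊓ γ) I

/-- Universal doctrine: right adjoints along projections, with the Beck-Chevalley condition. -/
def IsUniversal {C : Type u} [Category.{v} C] (P : Cᵒᵖ ⥤ SemilatInfCat.{w}) : Prop :=
  (∀ {X A : C} (pr : X ⟶ A), IsProjection pr →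
    ∃ U : P.obj (op X) → P.obj (op A), GaloisConnection (pull P pr) U) ∧
  (∀ {X' A' X A : C} (pr' : X' ⟶ A') (f' : X' ⟶ X) (f : A' ⟶ A) (pr : X ⟶ A),
    IsProjection pr → IsPullback pr' f' f pr →
    ∀ (U : P.obj (op X) → P.obj (op A)) (U' : P.obj (op X') → P.obj (op A')),
      GaloisConnection (pull P pr) U → GaloisConnection (pull P pr') U' →
      ∀ β : P.obj (op X), pull P f (U β) = U' (pull P f' β))

/-- `c : X ⟶ A` is a weak comprehension of `α ∈ P(A)`. -/
def IsWeakComprehension {C : Type u} [Category.{v} C] (P : Cᵒᵖ ⥤ SemilatInfCat.{w}) {X A : C}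
    (α : P.obj (op A)) (c : X ⟶ A) : Prop :=
  ⊤ ≤ pull P c α ∧ ∀ {Y : C} (g : Y ⟶ A), ⊤ ≤ pull P g α → ∃ h : Y ⟶ X, h ≫ c = g

/-- Fullness of a comprehension `c` of `α`. -/
def IsFull {C : Type u} [Category.{v} C] (P : Cᵒᵖ ⥤ SemilatInfCat.{w}) {X A : C}
    (α : P.obj (op A)) (c : X ⟶ A) : Prop :=
  ∀ β : P.obj (op A), ⊤ ≤ pull P c β → α ≤ β

/-- A weak pullback square (`fst ≫ f = snd ≫ g`, with existence of mediating arrows only). -/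
def IsWeakPullback {C : Type u} [Category.{v} C] {V B D A : C}
    (fst : V ⟶ B) (snd : V ⟶ D) (f : B ⟶ A) (g : D ⟶ A) : Prop :=
  fst ≫ f = snd ≫ g ∧
    ∀ {T : C} (s : T ⟶ B) (t : T ⟶ D), s ≫ f = t ≫ g → ∃ m : T ⟶ V, m ≫ fst = s ∧ m ≫ snd = t

/-- Stability of a weak comprehension `c` of `α`: every `P_f(α)` has a weak comprehension which
is part of a weak pullback of `c` along `f`. -/
def IsStable {C : Type u} [Category.{v} C] (P : Cᵒᵖ ⥤ SemilatInfCat.{w}) {X A : C}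
    (α : P.obj (op A)) (c : X ⟶ A) : Prop :=
  ∀ {A' : C} (f : A' ⟶ A), ∃ (X' : C) (c' : X' ⟶ A') (f' : X' ⟶ X),
    IsWeakComprehension P (pull P f α) c' ∧ IsWeakPullback c' f' f c

/-- Every `α` has a full weak comprehension (then all its weak comprehensions are full). -/
def HasFullWeakComprehensions {C : Type u} [Category.{v} C] (P : Cᵒᵖ ⥤ SemilatInfCat.{w}) : Prop :=
  ∀ (A : C) (α : P.obj (op A)), ∃ (X : C) (c : X ⟶ A),
    IsWeakComprehension P α c ∧ IsFull P α c

/-- Comprehensive weak equalizers: each diagonal `Δ_A` is a stable weak comprehension of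
`δ_A`, the value at `⊤` of the left adjoint to `P_{Δ_A}`. -/
def HasComprehensiveWeakEqualizers {C : Type u} [Category.{v} C] [HasFiniteProducts C]
    (P : Cᵒᵖ ⥤ SemilatInfCat.{w}) : Prop :=
  ∀ A : C, ∃ E : P.obj (op A) → P.obj (op (A ⨯ A)), GaloisConnection E (pull P (diag A)) ∧
    IsWeakComprehension P (E ⊤) (diag A) ∧ IsStable P (E ⊤) (diag A)

/-- Each pair of objects has a weak evaluation. -/
def WeaklyCartesianClosed (C : Type u) [Category.{v} C] [HasFiniteProducts C] : Prop :=
  ∀ A B : C, ∃ (W : C) (ev : W ⨯ A ⟶ B), ∀ {X : C} (f : X ⨯ A ⟶ B),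
    ∃ f' : X ⟶ W, f = prod.map f' (𝟙 A) ≫ ev

end Doctrine

/-! ## The minimal type theory `mtt` -/

namespace MTT

/-- Raw expressions (types and terms) of `mtt` with at most `n` free variables, with de Bruijn
indices: `var 0` is the variable declared last, and an argument in `Expr (n + k)` binds `k`
variables. -/
inductive Expr : ℕ → Type
  | var {n : ℕ} (i : Fin n) : Expr n
  -- types: indexed sum, empty set, singleton, lists, disjoint sum, dependent product
  | sigma {n : ℕ} (B : Expr n) (C : Expr (n + 1)) : Expr n
  | empty {n : ℕ} : Expr n
  | unit {n : ℕ} : Expr n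
  | list {n : ℕ} (B : Expr n) : Expr n
  | sum {n : ℕ} (B C : Expr n) : Expr n
  | pi {n : ℕ} (B : Expr n) (C : Expr (n + 1)) : Expr n
  -- types: collection of small propositions, functions from a set to it
  | propS {n : ℕ} : Expr n
  | funS {n : ℕ} (B : Expr n) : Expr n
  -- propositions
  | fls {n : ℕ} : Expr n
  | or {n : ℕ} (B C : Expr n) : Expr n
  | and {n : ℕ} (B C : Expr n) : Expr n
  | imp {n : ℕ} (B C : Expr n) : Expr n
  | ex {n : ℕ} (B : Expr n) (C : Expr (n + 1)) : Expr n
  | all {n : ℕ} (B : Expr n) (C : Expr (n + 1)) : Expr n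
  | id {n : ℕ} (A a b : Expr n) : Expr n
  | tau {n : ℕ} (p : Expr n) : Expr n
  -- terms of sets and collections
  | pair {n : ℕ} (b c : Expr n) : Expr n
  | elSigma {n : ℕ} (d : Expr n) (m : Expr (n + 2)) : Expr n
  | emp {n : ℕ} (a : Expr n) : Expr n
  | star {n : ℕ} : Expr n
  | elUnit {n : ℕ} (t c : Expr n) : Expr n
  | nil {n : ℕ} : Expr n
  | cons {n : ℕ} (s c : Expr n) : Expr n
  | elList {n : ℕ} (s a : Expr n) (l : Expr (n + 3)) : Expr n
  | inl {n : ℕ} (b : Expr n) : Expr n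
  | inr {n : ℕ} (c : Expr n) : Expr n
  | elSum {n : ℕ} (d : Expr n) (b c : Expr (n + 1)) : Expr n
  | lam {n : ℕ} (B : Expr n) (c : Expr (n + 1)) : Expr n
  | app {n : ℕ} (f b : Expr n) : Expr n
  -- codes of small propositions
  | flsC {n : ℕ} : Expr n
  | orC {n : ℕ} (p q : Expr n) : Expr n
  | andC {n : ℕ} (p q : Expr n) : Expr n
  | impC {n : ℕ} (p q : Expr n) : Expr n
  | exC {n : ℕ} (B : Expr n) (p : Expr (n + 1)) : Expr n
  | allC {n : ℕ} (B : Expr n) (p : Expr (n + 1)) : Expr n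
  | idC {n : ℕ} (A a b : Expr n) : Expr n
  -- proof-terms
  | elFls {n : ℕ} (a : Expr n) : Expr n
  | orInl {n : ℕ} (b : Expr n) : Expr n
  | orInr {n : ℕ} (c : Expr n) : Expr n
  | elOr {n : ℕ} (d : Expr n) (b c : Expr (n + 1)) : Expr n
  | andPair {n : ℕ} (b c : Expr n) : Expr n
  | andFst {n : ℕ} (d : Expr n) : Expr n
  | andSnd {n : ℕ} (d : Expr n) : Expr n
  | impLam {n : ℕ} (B : Expr n) (c : Expr (n + 1)) : Expr n
  | impApp {n : ℕ} (f b : Expr n) : Expr n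
  | exPair {n : ℕ} (b c : Expr n) : Expr n
  | elEx {n : ℕ} (d : Expr n) (m : Expr (n + 2)) : Expr n
  | allLam {n : ℕ} (B : Expr n) (c : Expr (n + 1)) : Expr n
  | allApp {n : ℕ} (f b : Expr n) : Expr n
  | idRefl {n : ℕ} (A a : Expr n) : Expr n
  | elId {n : ℕ} (p : Expr n) (c : Expr (n + 1)) : Expr n

namespace Expr

/-- Extension of a renaming under a binder. -/
def upr {n m : ℕ} (ρ : Fin n → Fin m) : Fin (n + 1) → Fin (m + 1) :=
  Fin.cases 0 (fun i => (ρ i).succ)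

/-- Renaming of variables. -/
def ren : {n m : ℕ} → (Fin n → Fin m) → Expr n → Expr m
  | _, _, ρ, var i => var (ρ i)
  | _, _, ρ, sigma B C => sigma (ren ρ B) (ren (upr ρ) C)
  | _, _, _, empty => empty
  | _, _, _, unit => unit
  | _, _, ρ, list B => list (ren ρ B)
  | _, _, ρ, sum B C => sum (ren ρ B) (ren ρ C)
  | _, _, ρ, pi B C => pi (ren ρ B) (ren (upr ρ) C)
  | _, _, _, propS => propS
  | _, _, ρ, funS B => funS (ren ρ B)
  | _, _, _, fls => fls
  | _, _, ρ, or B C => or (ren ρ B) (ren ρ C)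
  | _, _, ρ, and B C => and (ren ρ B) (ren ρ C)
  | _, _, ρ, imp B C => imp (ren ρ B) (ren ρ C)
  | _, _, ρ, ex B C => ex (ren ρ B) (ren (upr ρ) C)
  | _, _, ρ, all B C => all (ren ρ B) (ren (upr ρ) C)
  | _, _, ρ, id A a b => id (ren ρ A) (ren ρ a) (ren ρ b)
  | _, _, ρ, tau p => tau (ren ρ p)
  | _, _, ρ, pair b c => pair (ren ρ b) (ren ρ c)
  | _, _, ρ, elSigma d m => elSigma (ren ρ d) (ren (upr (upr ρ)) m)
  | _, _, ρ, emp a => emp (ren ρ a)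
  | _, _, _, star => star
  | _, _, ρ, elUnit t c => elUnit (ren ρ t) (ren ρ c)
  | _, _, _, nil => nil
  | _, _, ρ, cons s c => cons (ren ρ s) (ren ρ c)
  | _, _, ρ, elList s a l => elList (ren ρ s) (ren ρ a) (ren (upr (upr (upr ρ))) l)
  | _, _, ρ, inl b => inl (ren ρ b)
  | _, _, ρ, inr c => inr (ren ρ c)
  | _, _, ρ, elSum d b c => elSum (ren ρ d) (ren (upr ρ) b) (ren (upr ρ) c)
  | _, _, ρ, lam B c => lam (ren ρ B) (ren (upr ρ) c)
  | _, _, ρ, app f b => app (ren ρ f) (ren ρ b)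
  | _, _, _, flsC => flsC
  | _, _, ρ, orC p q => orC (ren ρ p) (ren ρ q)
  | _, _, ρ, andC p q => andC (ren ρ p) (ren ρ q)
  | _, _, ρ, impC p q => impC (ren ρ p) (ren ρ q)
  | _, _, ρ, exC B p => exC (ren ρ B) (ren (upr ρ) p)
  | _, _, ρ, allC B p => allC (ren ρ B) (ren (upr ρ) p)
  | _, _, ρ, idC A a b => idC (ren ρ A) (ren ρ a) (ren ρ b)
  | _, _, ρ, elFls a => elFls (ren ρ a)
  | _, _, ρ, orInl b => orInl (ren ρ b)
  | _, _, ρ, orInr c => orInr (ren ρ c)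
  | _, _, ρ, elOr d b c => elOr (ren ρ d) (ren (upr ρ) b) (ren (upr ρ) c)
  | _, _, ρ, andPair b c => andPair (ren ρ b) (ren ρ c)
  | _, _, ρ, andFst d => andFst (ren ρ d)
  | _, _, ρ, andSnd d => andSnd (ren ρ d)
  | _, _, ρ, impLam B c => impLam (ren ρ B) (ren (upr ρ) c)
  | _, _, ρ, impApp f b => impApp (ren ρ f) (ren ρ b)
  | _, _, ρ, exPair b c => exPair (ren ρ b) (ren ρ c)
  | _, _, ρ, elEx d m => elEx (ren ρ d) (ren (upr (upr ρ)) m)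
  | _, _, ρ, allLam B c => allLam (ren ρ B) (ren (upr ρ) c)
  | _, _, ρ, allApp f b => allApp (ren ρ f) (ren ρ b)
  | _, _, ρ, idRefl A a => idRefl (ren ρ A) (ren ρ a)
  | _, _, ρ, elId p c => elId (ren ρ p) (ren (upr ρ) c)

/-- Weakening by one new last variable. -/
def wk {n : ℕ} (e : Expr n) : Expr (n + 1) := ren Fin.succ e

/-- Extension of a substitution under a binder. -/
def up {n m : ℕ} (σ : Fin n → Expr m) : Fin (n + 1) → Expr (m + 1) :=
  Fin.cases (var 0) (fun i => wk (σ i))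

/-- Simultaneous capture-free substitution. -/
def subst : {n m : ℕ} → (Fin n → Expr m) → Expr n → Expr m
  | _, _, σ, var i => σ i
  | _, _, σ, sigma B C => sigma (subst σ B) (subst (up σ) C)
  | _, _, _, empty => empty
  | _, _, _, unit => unit
  | _, _, σ, list B => list (subst σ B)
  | _, _, σ, sum B C => sum (subst σ B) (subst σ C)
  | _, _, σ, pi B C => pi (subst σ B) (subst (up σ) C)
  | _, _, _, propS => propS
  | _, _, σ, funS B => funS (subst σ B)
  | _, _, _, fls => fls
  | _, _, σ, or B C => or (subst σ B) (subst σ C)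
  | _, _, σ, and B C => and (subst σ B) (subst σ C)
  | _, _, σ, imp B C => imp (subst σ B) (subst σ C)
  | _, _, σ, ex B C => ex (subst σ B) (subst (up σ) C)
  | _, _, σ, all B C => all (subst σ B) (subst (up σ) C)
  | _, _, σ, id A a b => id (subst σ A) (subst σ a) (subst σ b)
  | _, _, σ, tau p => tau (subst σ p)
  | _, _, σ, pair b c => pair (subst σ b) (subst σ c)
  | _, _, σ, elSigma d m => elSigma (subst σ d) (subst (up (up σ)) m)
  | _, _, σ, emp a => emp (subst σ a)
  | _, _, _, star => star
  | _, _, σ, elUnit t c => elUnit (subst σ t) (subst σ c)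
  | _, _, _, nil => nil
  | _, _, σ, cons s c => cons (subst σ s) (subst σ c)
  | _, _, σ, elList s a l => elList (subst σ s) (subst σ a) (subst (up (up (up σ))) l)
  | _, _, σ, inl b => inl (subst σ b)
  | _, _, σ, inr c => inr (subst σ c)
  | _, _, σ, elSum d b c => elSum (subst σ d) (subst (up σ) b) (subst (up σ) c)
  | _, _, σ, lam B c => lam (subst σ B) (subst (up σ) c)
  | _, _, σ, app f b => app (subst σ f) (subst σ b)
  | _, _, _, flsC => flsC
  | _, _, σ, orC p q => orC (subst σ p) (subst σ q)
  | _, _, σ, andC p q => andC (subst σ p) (subst σ q)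
  | _, _, σ, impC p q => impC (subst σ p) (subst σ q)
  | _, _, σ, exC B p => exC (subst σ B) (subst (up σ) p)
  | _, _, σ, allC B p => allC (subst σ B) (subst (up σ) p)
  | _, _, σ, idC A a b => idC (subst σ A) (subst σ a) (subst σ b)
  | _, _, σ, elFls a => elFls (subst σ a)
  | _, _, σ, orInl b => orInl (subst σ b)
  | _, _, σ, orInr c => orInr (subst σ c)
  | _, _, σ, elOr d b c => elOr (subst σ d) (subst (up σ) b) (subst (up σ) c)
  | _, _, σ, andPair b c => andPair (subst σ b) (subst σ c)
  | _, _, σ, andFst d => andFst (subst σ d)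
  | _, _, σ, andSnd d => andSnd (subst σ d)
  | _, _, σ, impLam B c => impLam (subst σ B) (subst (up σ) c)
  | _, _, σ, impApp f b => impApp (subst σ f) (subst σ b)
  | _, _, σ, exPair b c => exPair (subst σ b) (subst σ c)
  | _, _, σ, elEx d m => elEx (subst σ d) (subst (up (up σ)) m)
  | _, _, σ, allLam B c => allLam (subst σ B) (subst (up σ) c)
  | _, _, σ, allApp f b => allApp (subst σ f) (subst σ b)
  | _, _, σ, idRefl A a => idRefl (subst σ A) (subst σ a)
  | _, _, σ, elId p c => elId (subst σ p) (subst (up σ) c)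

/-- The substitution `σ` extended by `e` for the last variable. -/
def scons {n m : ℕ} (e : Expr m) (σ : Fin n → Expr m) : Fin (n + 1) → Expr m :=
  Fin.cases e σ

/-- `C(b)` for `C(x)` with `x` the last variable. -/
def inst {n : ℕ} (C : Expr (n + 1)) (b : Expr n) : Expr n := subst (scons b var) C

/-- `C(b, c)` for `C(x, y)` with `x`, `y` the last two variables. -/
def inst₂ {n : ℕ} (C : Expr (n + 2)) (b c : Expr n) : Expr n := subst (scons c (scons b var)) C

/-- `C(a, b, c)` for `C(x, y, z)` with `x`, `y`, `z` the last three variables. -/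
def inst₃ {n : ℕ} (C : Expr (n + 3)) (a b c : Expr n) : Expr n :=
  subst (scons c (scons b (scons a var))) C

/-- `M(e)` for `M(z)` with `z` the last variable, where `e` lives in a context with `k` more
variables. -/
def instAt {n : ℕ} (k : ℕ) (M : Expr (n + 1)) (e : Expr (n + k)) : Expr (n + k) :=
  subst (scons e (fun i => var (i.addNat k))) M

theorem upr_comp {n m k : ℕ} (ρ : Fin n → Fin m) (τ : Fin m → Fin k) :
    (fun i => upr τ (upr ρ i)) = upr (fun i => τ (ρ i)) := by
  funext i; refine Fin.cases rfl (fun i => rfl) i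

theorem ren_ren {n m k : ℕ} (ρ : Fin n → Fin m) (τ : Fin m → Fin k) (e : Expr n) :
    ren τ (ren ρ e) = ren (fun i => τ (ρ i)) e := by
  induction e generalizing m k <;> simp [ren, upr_comp, *]

theorem up_upr {n m k : ℕ} (ρ : Fin n → Fin m) (σ : Fin m → Expr k) :
    (fun i => up σ (upr ρ i)) = up (fun i => σ (ρ i)) := by
  funext i; refine Fin.cases rfl (fun i => rfl) i

theorem subst_ren {n m k : ℕ} (ρ : Fin n → Fin m) (σ : Fin m → Expr k) (e : Expr n) :
    subst σ (ren ρ e) = subst (fun i => σ (ρ i)) e := by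
  induction e generalizing m k <;> simp [ren, subst, up_upr, *]

theorem ren_up {n m k : ℕ} (σ : Fin n → Expr m) (τ : Fin m → Fin k) :
    (fun i => ren (upr τ) (up σ i)) = up (fun i => ren τ (σ i)) := by
  funext i
  refine Fin.cases rfl (fun i => ?_) i
  simp [up, wk, ren_ren, upr]

theorem ren_subst {n m k : ℕ} (σ : Fin n → Expr m) (τ : Fin m → Fin k) (e : Expr n) :
    ren τ (subst σ e) = subst (fun i => ren τ (σ i)) e := by
  induction e generalizing m k <;> simp [ren, subst, ren_up, *]

theorem subst_up {n m k : ℕ} (σ : Fin n → Expr m) (τ : Fin m → Expr k) :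
    (fun i => subst (up τ) (up σ i)) = up (fun i => subst τ (σ i)) := by
  funext i
  refine Fin.cases rfl (fun i => ?_) i
  simp [up, wk, subst_ren, ren_subst]

theorem subst_subst {n m k : ℕ} (σ : Fin n → Expr m) (τ : Fin m → Expr k) (e : Expr n) :
    subst τ (subst σ e) = subst (fun i => subst τ (σ i)) e := by
  induction e generalizing m k <;> simp [subst, subst_up, *]

theorem up_var {n : ℕ} : up (var : Fin n → Expr n) = var := by
  funext i; refine Fin.cases rfl (fun i => rfl) i

theorem subst_var {n : ℕ} (e : Expr n) : subst var e = e := by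
  induction e <;> simp [subst, up_var, *]

theorem ren_eq_subst {n m : ℕ} (ρ : Fin n → Fin m) (e : Expr n) :
    ren ρ e = subst (fun i => var (ρ i)) e := by
  rw [← subst_ren, subst_var]

end Expr

/-- Contexts with `n` declarations. -/
inductive Ctx : ℕ → Type
  | nil : Ctx 0
  | snoc {n : ℕ} (Γ : Ctx n) (A : Expr n) : Ctx (n + 1)

/-- The type declared for a variable, weakened to the whole context. -/
def Ctx.get : {n : ℕ} → Ctx n → Fin n → Expr n
  | _, .nil => fun i => i.elim0
  | _, .snoc Γ A => Fin.cases A.wk (fun i => (Γ.get i).wk)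

/-- The four kinds of types: collections, sets, propositions, small propositions. -/
inductive Kind
  | col
  | set
  | prop
  | props

/-- The forms of judgement, relative to a context: being a context; `A type`;
`A = B type`; `a ∈ A`; `a = b ∈ A`; here `type` is one of the four kinds. -/
inductive Judgment (n : ℕ) : Type
  | ctx : Judgment n
  | type (K : Kind) (A : Expr n) : Judgment n
  | typeEq (K : Kind) (A B : Expr n) : Judgment n
  | tm (a A : Expr n) : Judgment n
  | tmEq (a b A : Expr n) : Judgment n

/-- Substitution in judgements. -/
def Judgment.subst {n m : ℕ} (σ : Fin n → Expr m) : Judgment n → Judgment m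
  | .ctx => .ctx
  | .type K A => .type K (Expr.subst σ A)
  | .typeEq K A B => .typeEq K (Expr.subst σ A) (B.subst σ)
  | .tm a A => .tm (a.subst σ) (Expr.subst σ A)
  | .tmEq a b A => .tmEq (a.subst σ) (b.subst σ) (Expr.subst σ A)

/-- Derivability of the judgement `J` in the context `Γ`. Equal terms can be substituted in types
and terms (`type_congr`, `tm_congr`), but there are no congruence rules under binders (in
particular no `ξ`-rule); propositions eliminate only towards propositions. -/
inductive Derivable : {n : ℕ} → Ctx n → Judgment n → Prop
  -- contexts, variables, substitution
  | ctx_nil : Derivable .nil .ctx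
  | ctx_snoc {n : ℕ} {Γ : Ctx n} {A : Expr n} :
      Derivable Γ (.type .col A) → Derivable (Γ.snoc A) .ctx
  | var {n : ℕ} {Γ : Ctx n} (i : Fin n) :
      Derivable Γ .ctx → Derivable Γ (.tm (.var i) (Γ.get i))
  | subst {n m : ℕ} {Γ : Ctx n} {Δ : Ctx m} {J : Judgment n} (σ : Fin n → Expr m) :
      Derivable Γ J → Derivable Δ .ctx →
      (∀ i, Derivable Δ (.tm (σ i) ((Γ.get i).subst σ))) →
      Derivable Δ (J.subst σ)
  | type_congr {n m : ℕ} {Γ : Ctx n} {Δ : Ctx m} {K : Kind} {A : Expr n} (σ τ : Fin n → Expr m) :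
      Derivable Γ (.type K A) → Derivable Δ .ctx →
      (∀ i, Derivable Δ (.tmEq (σ i) (τ i) ((Γ.get i).subst σ))) →
      Derivable Δ (.typeEq K (A.subst σ) (A.subst τ))
  | tm_congr {n m : ℕ} {Γ : Ctx n} {Δ : Ctx m} {a A : Expr n} (σ τ : Fin n → Expr m) :
      Derivable Γ (.tm a A) → Derivable Δ .ctx →
      (∀ i, Derivable Δ (.tmEq (σ i) (τ i) ((Γ.get i).subst σ))) →
      Derivable Δ (.tmEq (a.subst σ) (a.subst τ) (A.subst σ))
  -- equality
  | type_refl {n : ℕ} {Γ : Ctx n} {K : Kind} {A : Expr n} :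
      Derivable Γ (.type K A) → Derivable Γ (.typeEq K A A)
  | type_symm {n : ℕ} {Γ : Ctx n} {K : Kind} {A B : Expr n} :
      Derivable Γ (.typeEq K A B) → Derivable Γ (.typeEq K B A)
  | type_trans {n : ℕ} {Γ : Ctx n} {K : Kind} {A B C : Expr n} :
      Derivable Γ (.typeEq K A B) → Derivable Γ (.typeEq K B C) → Derivable Γ (.typeEq K A C)
  | tm_refl {n : ℕ} {Γ : Ctx n} {a A : Expr n} :
      Derivable Γ (.tm a A) → Derivable Γ (.tmEq a a A)
  | tm_symm {n : ℕ} {Γ : Ctx n} {a b A : Expr n} :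
      Derivable Γ (.tmEq a b A) → Derivable Γ (.tmEq b a A)
  | tm_trans {n : ℕ} {Γ : Ctx n} {a b c A : Expr n} :
      Derivable Γ (.tmEq a b A) → Derivable Γ (.tmEq b c A) → Derivable Γ (.tmEq a c A)
  | conv {n : ℕ} {Γ : Ctx n} {a A B : Expr n} :
      Derivable Γ (.tm a A) → Derivable Γ (.typeEq .col A B) → Derivable Γ (.tm a B)
  | conv_eq {n : ℕ} {Γ : Ctx n} {a b A B : Expr n} :
      Derivable Γ (.tmEq a b A) → Derivable Γ (.typeEq .col A B) → Derivable Γ (.tmEq a b B)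
  -- inclusions among the kinds of types
  | set_col {n : ℕ} {Γ : Ctx n} {A : Expr n} :
      Derivable Γ (.type .set A) → Derivable Γ (.type .col A)
  | prop_col {n : ℕ} {Γ : Ctx n} {A : Expr n} :
      Derivable Γ (.type .prop A) → Derivable Γ (.type .col A)
  | props_set {n : ℕ} {Γ : Ctx n} {A : Expr n} :
      Derivable Γ (.type .props A) → Derivable Γ (.type .set A)
  | props_prop {n : ℕ} {Γ : Ctx n} {A : Expr n} :
      Derivable Γ (.type .props A) → Derivable Γ (.type .prop A)
  | set_col_eq {n : ℕ} {Γ : Ctx n} {A B : Expr n} :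
      Derivable Γ (.typeEq .set A B) → Derivable Γ (.typeEq .col A B)
  | prop_col_eq {n : ℕ} {Γ : Ctx n} {A B : Expr n} :
      Derivable Γ (.typeEq .prop A B) → Derivable Γ (.typeEq .col A B)
  | props_set_eq {n : ℕ} {Γ : Ctx n} {A B : Expr n} :
      Derivable Γ (.typeEq .props A B) → Derivable Γ (.typeEq .set A B)
  | props_prop_eq {n : ℕ} {Γ : Ctx n} {A B : Expr n} :
      Derivable Γ (.typeEq .props A B) → Derivable Γ (.typeEq .prop A B)
  -- strong indexed sums of collections and of sets
  | sigma_col {n : ℕ} {Γ : Ctx n} {B : Expr n} {C : Expr (n + 1)} :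
      Derivable Γ (.type .col B) → Derivable (Γ.snoc B) (.type .col C) →
      Derivable Γ (.type .col (.sigma B C))
  | sigma_set {n : ℕ} {Γ : Ctx n} {B : Expr n} {C : Expr (n + 1)} :
      Derivable Γ (.type .set B) → Derivable (Γ.snoc B) (.type .set C) →
      Derivable Γ (.type .set (.sigma B C))
  | pair {n : ℕ} {Γ : Ctx n} {B b c : Expr n} {C : Expr (n + 1)} :
      Derivable (Γ.snoc B) (.type .col C) →
      Derivable Γ (.tm b B) → Derivable Γ (.tm c (C.inst b)) →
      Derivable Γ (.tm (.pair b c) (.sigma B C))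
  | elSigma {n : ℕ} {Γ : Ctx n} {B d : Expr n} {C M : Expr (n + 1)} {m : Expr (n + 2)} :
      Derivable (Γ.snoc (.sigma B C)) (.type .col M) →
      Derivable Γ (.tm d (.sigma B C)) →
      Derivable ((Γ.snoc B).snoc C) (.tm m (M.instAt 2 (.pair (.var 1) (.var 0)))) →
      Derivable Γ (.tm (.elSigma d m) (M.inst d))
  | elSigma_pair {n : ℕ} {Γ : Ctx n} {B b c : Expr n} {C M : Expr (n + 1)} {m : Expr (n + 2)} :
      Derivable (Γ.snoc (.sigma B C)) (.type .col M) →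
      Derivable Γ (.tm b B) → Derivable Γ (.tm c (C.inst b)) →
      Derivable ((Γ.snoc B).snoc C) (.tm m (M.instAt 2 (.pair (.var 1) (.var 0)))) →
      Derivable Γ (.tmEq (.elSigma (.pair b c) m) (m.inst₂ b c) (M.inst (.pair b c)))
  -- empty set
  | empty {n : ℕ} {Γ : Ctx n} : Derivable Γ .ctx → Derivable Γ (.type .set .empty)
  | emp {n : ℕ} {Γ : Ctx n} {a : Expr n} {M : Expr (n + 1)} :
      Derivable (Γ.snoc .empty) (.type .col M) → Derivable Γ (.tm a .empty) →
      Derivable Γ (.tm (.emp a) (M.inst a))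
  -- singleton
  | unit {n : ℕ} {Γ : Ctx n} : Derivable Γ .ctx → Derivable Γ (.type .set .unit)
  | star {n : ℕ} {Γ : Ctx n} : Derivable Γ .ctx → Derivable Γ (.tm .star .unit)
  | elUnit {n : ℕ} {Γ : Ctx n} {t c : Expr n} {M : Expr (n + 1)} :
      Derivable (Γ.snoc .unit) (.type .col M) → Derivable Γ (.tm t .unit) →
      Derivable Γ (.tm c (M.inst .star)) →
      Derivable Γ (.tm (.elUnit t c) (M.inst t))
  | elUnit_star {n : ℕ} {Γ : Ctx n} {c : Expr n} {M : Expr (n + 1)} :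
      Derivable (Γ.snoc .unit) (.type .col M) → Derivable Γ (.tm c (M.inst .star)) →
      Derivable Γ (.tmEq (.elUnit .star c) c (M.inst .star))
  -- lists on a set
  | list {n : ℕ} {Γ : Ctx n} {B : Expr n} :
      Derivable Γ (.type .set B) → Derivable Γ (.type .set (.list B))
  | nil {n : ℕ} {Γ : Ctx n} {B : Expr n} :
      Derivable Γ (.type .set B) → Derivable Γ (.tm .nil (.list B))
  | cons {n : ℕ} {Γ : Ctx n} {B s b : Expr n} :
      Derivable Γ (.type .set B) → Derivable Γ (.tm s (.list B)) → Derivable Γ (.tm b B) →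
      Derivable Γ (.tm (.cons s b) (.list B))
  | elList {n : ℕ} {Γ : Ctx n} {B s a : Expr n} {M : Expr (n + 1)} {l : Expr (n + 3)} :
      Derivable Γ (.type .set B) → Derivable (Γ.snoc (.list B)) (.type .col M) →
      Derivable Γ (.tm s (.list B)) → Derivable Γ (.tm a (M.inst .nil)) →
      Derivable (((Γ.snoc (.list B)).snoc B.wk).snoc (M.instAt 2 (.var 1)))
        (.tm l (M.instAt 3 (.cons (.var 2) (.var 1)))) →
      Derivable Γ (.tm (.elList s a l) (M.inst s))
  | elList_nil {n : ℕ} {Γ : Ctx n} {B a : Expr n} {M : Expr (n + 1)} {l : Expr (n + 3)} :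
      Derivable Γ (.type .set B) → Derivable (Γ.snoc (.list B)) (.type .col M) →
      Derivable Γ (.tm a (M.inst .nil)) →
      Derivable (((Γ.snoc (.list B)).snoc B.wk).snoc (M.instAt 2 (.var 1)))
        (.tm l (M.instAt 3 (.cons (.var 2) (.var 1)))) →
      Derivable Γ (.tmEq (.elList .nil a l) a (M.inst .nil))
  | elList_cons {n : ℕ} {Γ : Ctx n} {B s b a : Expr n} {M : Expr (n + 1)} {l : Expr (n + 3)} :
      Derivable Γ (.type .set B) → Derivable (Γ.snoc (.list B)) (.type .col M) →
      Derivable Γ (.tm s (.list B)) → Derivable Γ (.tm b B) → Derivable Γ (.tm a (M.inst .nil)) →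
      Derivable (((Γ.snoc (.list B)).snoc B.wk).snoc (M.instAt 2 (.var 1)))
        (.tm l (M.instAt 3 (.cons (.var 2) (.var 1)))) →
      Derivable Γ (.tmEq (.elList (.cons s b) a l) (l.inst₃ s b (.elList s a l))
        (M.inst (.cons s b)))
  -- disjoint sum of sets
  | sum {n : ℕ} {Γ : Ctx n} {B C : Expr n} :
      Derivable Γ (.type .set B) → Derivable Γ (.type .set C) →
      Derivable Γ (.type .set (.sum B C))
  | inl {n : ℕ} {Γ : Ctx n} {B C b : Expr n} :
      Derivable Γ (.type .set B) → Derivable Γ (.type .set C) → Derivable Γ (.tm b B) →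
      Derivable Γ (.tm (.inl b) (.sum B C))
  | inr {n : ℕ} {Γ : Ctx n} {B C c : Expr n} :
      Derivable Γ (.type .set B) → Derivable Γ (.type .set C) → Derivable Γ (.tm c C) →
      Derivable Γ (.tm (.inr c) (.sum B C))
  | elSum {n : ℕ} {Γ : Ctx n} {B C d : Expr n} {M b c : Expr (n + 1)} :
      Derivable (Γ.snoc (.sum B C)) (.type .col M) → Derivable Γ (.tm d (.sum B C)) →
      Derivable (Γ.snoc B) (.tm b (M.instAt 1 (.inl (.var 0)))) →
      Derivable (Γ.snoc C) (.tm c (M.instAt 1 (.inr (.var 0)))) →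
      Derivable Γ (.tm (.elSum d b c) (M.inst d))
  | elSum_inl {n : ℕ} {Γ : Ctx n} {B C e : Expr n} {M b c : Expr (n + 1)} :
      Derivable (Γ.snoc (.sum B C)) (.type .col M) → Derivable Γ (.tm e B) →
      Derivable (Γ.snoc B) (.tm b (M.instAt 1 (.inl (.var 0)))) →
      Derivable (Γ.snoc C) (.tm c (M.instAt 1 (.inr (.var 0)))) →
      Derivable Γ (.tmEq (.elSum (.inl e) b c) (b.inst e) (M.inst (.inl e)))
  | elSum_inr {n : ℕ} {Γ : Ctx n} {B C e : Expr n} {M b c : Expr (n + 1)} :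
      Derivable (Γ.snoc (.sum B C)) (.type .col M) → Derivable Γ (.tm e C) →
      Derivable (Γ.snoc B) (.tm b (M.instAt 1 (.inl (.var 0)))) →
      Derivable (Γ.snoc C) (.tm c (M.instAt 1 (.inr (.var 0)))) →
      Derivable Γ (.tmEq (.elSum (.inr e) b c) (c.inst e) (M.inst (.inr e)))
  -- dependent products of sets
  | pi {n : ℕ} {Γ : Ctx n} {B : Expr n} {C : Expr (n + 1)} :
      Derivable Γ (.type .set B) → Derivable (Γ.snoc B) (.type .set C) →
      Derivable Γ (.type .set (.pi B C))
  | lam {n : ℕ} {Γ : Ctx n} {B : Expr n} {C c : Expr (n + 1)} :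
      Derivable Γ (.type .set B) → Derivable (Γ.snoc B) (.type .set C) →
      Derivable (Γ.snoc B) (.tm c C) →
      Derivable Γ (.tm (.lam B c) (.pi B C))
  | app {n : ℕ} {Γ : Ctx n} {B f b : Expr n} {C : Expr (n + 1)} :
      Derivable Γ (.tm f (.pi B C)) → Derivable Γ (.tm b B) →
      Derivable Γ (.tm (.app f b) (C.inst b))
  | app_lam {n : ℕ} {Γ : Ctx n} {B b : Expr n} {C c : Expr (n + 1)} :
      Derivable Γ (.type .set B) → Derivable (Γ.snoc B) (.type .set C) →
      Derivable (Γ.snoc B) (.tm c C) → Derivable Γ (.tm b B) →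
      Derivable Γ (.tmEq (.app (.lam B c) b) (c.inst b) (C.inst b))
  -- the collection of (codes of) small propositions
  | propS {n : ℕ} {Γ : Ctx n} : Derivable Γ .ctx → Derivable Γ (.type .col .propS)
  | flsC {n : ℕ} {Γ : Ctx n} : Derivable Γ .ctx → Derivable Γ (.tm .flsC .propS)
  | orC {n : ℕ} {Γ : Ctx n} {p q : Expr n} :
      Derivable Γ (.tm p .propS) → Derivable Γ (.tm q .propS) →
      Derivable Γ (.tm (.orC p q) .propS)
  | andC {n : ℕ} {Γ : Ctx n} {p q : Expr n} :
      Derivable Γ (.tm p .propS) → Derivable Γ (.tm q .propS) →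
      Derivable Γ (.tm (.andC p q) .propS)
  | impC {n : ℕ} {Γ : Ctx n} {p q : Expr n} :
      Derivable Γ (.tm p .propS) → Derivable Γ (.tm q .propS) →
      Derivable Γ (.tm (.impC p q) .propS)
  | exC {n : ℕ} {Γ : Ctx n} {B : Expr n} {p : Expr (n + 1)} :
      Derivable Γ (.type .set B) → Derivable (Γ.snoc B) (.tm p .propS) →
      Derivable Γ (.tm (.exC B p) .propS)
  | allC {n : ℕ} {Γ : Ctx n} {B : Expr n} {p : Expr (n + 1)} :
      Derivable Γ (.type .set B) → Derivable (Γ.snoc B) (.tm p .propS) →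
      Derivable Γ (.tm (.allC B p) .propS)
  | idC {n : ℕ} {Γ : Ctx n} {A a b : Expr n} :
      Derivable Γ (.type .set A) → Derivable Γ (.tm a A) → Derivable Γ (.tm b A) →
      Derivable Γ (.tm (.idC A a b) .propS)
  | tau {n : ℕ} {Γ : Ctx n} {p : Expr n} :
      Derivable Γ (.tm p .propS) → Derivable Γ (.type .props (.tau p))
  | tau_fls {n : ℕ} {Γ : Ctx n} :
      Derivable Γ .ctx → Derivable Γ (.typeEq .props (.tau .flsC) .fls)
  | tau_or {n : ℕ} {Γ : Ctx n} {p q : Expr n} :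
      Derivable Γ (.tm p .propS) → Derivable Γ (.tm q .propS) →
      Derivable Γ (.typeEq .props (.tau (.orC p q)) (.or (.tau p) (.tau q)))
  | tau_and {n : ℕ} {Γ : Ctx n} {p q : Expr n} :
      Derivable Γ (.tm p .propS) → Derivable Γ (.tm q .propS) →
      Derivable Γ (.typeEq .props (.tau (.andC p q)) (.and (.tau p) (.tau q)))
  | tau_imp {n : ℕ} {Γ : Ctx n} {p q : Expr n} :
      Derivable Γ (.tm p .propS) → Derivable Γ (.tm q .propS) →
      Derivable Γ (.typeEq .props (.tau (.impC p q)) (.imp (.tau p) (.tau q)))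
  | tau_ex {n : ℕ} {Γ : Ctx n} {B : Expr n} {p : Expr (n + 1)} :
      Derivable Γ (.type .set B) → Derivable (Γ.snoc B) (.tm p .propS) →
      Derivable Γ (.typeEq .props (.tau (.exC B p)) (.ex B (.tau p)))
  | tau_all {n : ℕ} {Γ : Ctx n} {B : Expr n} {p : Expr (n + 1)} :
      Derivable Γ (.type .set B) → Derivable (Γ.snoc B) (.tm p .propS) →
      Derivable Γ (.typeEq .props (.tau (.allC B p)) (.all B (.tau p)))
  | tau_id {n : ℕ} {Γ : Ctx n} {A a b : Expr n} :
      Derivable Γ (.type .set A) → Derivable Γ (.tm a A) → Derivable Γ (.tm b A) →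
      Derivable Γ (.typeEq .props (.tau (.idC A a b)) (.id A a b))
  -- collections of functions from a set to the collection of small propositions
  | funS {n : ℕ} {Γ : Ctx n} {B : Expr n} :
      Derivable Γ (.type .set B) → Derivable Γ (.type .col (.funS B))
  | funS_lam {n : ℕ} {Γ : Ctx n} {B : Expr n} {c : Expr (n + 1)} :
      Derivable Γ (.type .set B) → Derivable (Γ.snoc B) (.tm c .propS) →
      Derivable Γ (.tm (.lam B c) (.funS B))
  | funS_app {n : ℕ} {Γ : Ctx n} {B f b : Expr n} :
      Derivable Γ (.tm f (.funS B)) → Derivable Γ (.tm b B) →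
      Derivable Γ (.tm (.app f b) .propS)
  | funS_app_lam {n : ℕ} {Γ : Ctx n} {B b : Expr n} {c : Expr (n + 1)} :
      Derivable Γ (.type .set B) → Derivable (Γ.snoc B) (.tm c .propS) → Derivable Γ (.tm b B) →
      Derivable Γ (.tmEq (.app (.lam B c) b) (c.inst b) .propS)
  -- formation of propositions
  | fls_prop {n : ℕ} {Γ : Ctx n} : Derivable Γ .ctx → Derivable Γ (.type .prop .fls)
  | or_prop {n : ℕ} {Γ : Ctx n} {B C : Expr n} :
      Derivable Γ (.type .prop B) → Derivable Γ (.type .prop C) →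
      Derivable Γ (.type .prop (.or B C))
  | and_prop {n : ℕ} {Γ : Ctx n} {B C : Expr n} :
      Derivable Γ (.type .prop B) → Derivable Γ (.type .prop C) →
      Derivable Γ (.type .prop (.and B C))
  | imp_prop {n : ℕ} {Γ : Ctx n} {B C : Expr n} :
      Derivable Γ (.type .prop B) → Derivable Γ (.type .prop C) →
      Derivable Γ (.type .prop (.imp B C))
  | ex_prop {n : ℕ} {Γ : Ctx n} {B : Expr n} {C : Expr (n + 1)} :
      Derivable Γ (.type .col B) → Derivable (Γ.snoc B) (.type .prop C) →
      Derivable Γ (.type .prop (.ex B C))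
  | all_prop {n : ℕ} {Γ : Ctx n} {B : Expr n} {C : Expr (n + 1)} :
      Derivable Γ (.type .col B) → Derivable (Γ.snoc B) (.type .prop C) →
      Derivable Γ (.type .prop (.all B C))
  | id_prop {n : ℕ} {Γ : Ctx n} {A a b : Expr n} :
      Derivable Γ (.type .col A) → Derivable Γ (.tm a A) → Derivable Γ (.tm b A) →
      Derivable Γ (.type .prop (.id A a b))
  -- formation of small propositions: quantification and equality are restricted to sets
  | fls_props {n : ℕ} {Γ : Ctx n} : Derivable Γ .ctx → Derivable Γ (.type .props .fls)
  | or_props {n : ℕ} {Γ : Ctx n} {B C : Expr n} :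
      Derivable Γ (.type .props B) → Derivable Γ (.type .props C) →
      Derivable Γ (.type .props (.or B C))
  | and_props {n : ℕ} {Γ : Ctx n} {B C : Expr n} :
      Derivable Γ (.type .props B) → Derivable Γ (.type .props C) →
      Derivable Γ (.type .props (.and B C))
  | imp_props {n : ℕ} {Γ : Ctx n} {B C : Expr n} :
      Derivable Γ (.type .props B) → Derivable Γ (.type .props C) →
      Derivable Γ (.type .props (.imp B C))
  | ex_props {n : ℕ} {Γ : Ctx n} {B : Expr n} {C : Expr (n + 1)} :
      Derivable Γ (.type .set B) → Derivable (Γ.snoc B) (.type .props C) →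
      Derivable Γ (.type .props (.ex B C))
  | all_props {n : ℕ} {Γ : Ctx n} {B : Expr n} {C : Expr (n + 1)} :
      Derivable Γ (.type .set B) → Derivable (Γ.snoc B) (.type .props C) →
      Derivable Γ (.type .props (.all B C))
  | id_props {n : ℕ} {Γ : Ctx n} {A a b : Expr n} :
      Derivable Γ (.type .set A) → Derivable Γ (.tm a A) → Derivable Γ (.tm b A) →
      Derivable Γ (.type .props (.id A a b))
  -- falsum
  | elFls {n : ℕ} {Γ : Ctx n} {a A : Expr n} :
      Derivable Γ (.type .prop A) → Derivable Γ (.tm a .fls) → Derivable Γ (.tm (.elFls a) A)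
  -- disjunction
  | orInl {n : ℕ} {Γ : Ctx n} {B C b : Expr n} :
      Derivable Γ (.type .prop B) → Derivable Γ (.type .prop C) → Derivable Γ (.tm b B) →
      Derivable Γ (.tm (.orInl b) (.or B C))
  | orInr {n : ℕ} {Γ : Ctx n} {B C c : Expr n} :
      Derivable Γ (.type .prop B) → Derivable Γ (.type .prop C) → Derivable Γ (.tm c C) →
      Derivable Γ (.tm (.orInr c) (.or B C))
  | elOr {n : ℕ} {Γ : Ctx n} {B C A d : Expr n} {b c : Expr (n + 1)} :
      Derivable Γ (.type .prop A) → Derivable Γ (.tm d (.or B C)) →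
      Derivable (Γ.snoc B) (.tm b A.wk) → Derivable (Γ.snoc C) (.tm c A.wk) →
      Derivable Γ (.tm (.elOr d b c) A)
  | elOr_inl {n : ℕ} {Γ : Ctx n} {B C A e : Expr n} {b c : Expr (n + 1)} :
      Derivable Γ (.type .prop A) → Derivable Γ (.type .prop B) → Derivable Γ (.type .prop C) →
      Derivable Γ (.tm e B) →
      Derivable (Γ.snoc B) (.tm b A.wk) → Derivable (Γ.snoc C) (.tm c A.wk) →
      Derivable Γ (.tmEq (.elOr (.orInl e) b c) (b.inst e) A)
  | elOr_inr {n : ℕ} {Γ : Ctx n} {B C A e : Expr n} {b c : Expr (n + 1)} :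
      Derivable Γ (.type .prop A) → Derivable Γ (.type .prop B) → Derivable Γ (.type .prop C) →
      Derivable Γ (.tm e C) →
      Derivable (Γ.snoc B) (.tm b A.wk) → Derivable (Γ.snoc C) (.tm c A.wk) →
      Derivable Γ (.tmEq (.elOr (.orInr e) b c) (c.inst e) A)
  -- conjunction
  | andPair {n : ℕ} {Γ : Ctx n} {B C b c : Expr n} :
      Derivable Γ (.type .prop B) → Derivable Γ (.type .prop C) →
      Derivable Γ (.tm b B) → Derivable Γ (.tm c C) →
      Derivable Γ (.tm (.andPair b c) (.and B C))
  | andFst {n : ℕ} {Γ : Ctx n} {B C d : Expr n} :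
      Derivable Γ (.tm d (.and B C)) → Derivable Γ (.tm (.andFst d) B)
  | andSnd {n : ℕ} {Γ : Ctx n} {B C d : Expr n} :
      Derivable Γ (.tm d (.and B C)) → Derivable Γ (.tm (.andSnd d) C)
  | andFst_pair {n : ℕ} {Γ : Ctx n} {B C b c : Expr n} :
      Derivable Γ (.type .prop B) → Derivable Γ (.type .prop C) →
      Derivable Γ (.tm b B) → Derivable Γ (.tm c C) →
      Derivable Γ (.tmEq (.andFst (.andPair b c)) b B)
  | andSnd_pair {n : ℕ} {Γ : Ctx n} {B C b c : Expr n} :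
      Derivable Γ (.type .prop B) → Derivable Γ (.type .prop C) →
      Derivable Γ (.tm b B) → Derivable Γ (.tm c C) →
      Derivable Γ (.tmEq (.andSnd (.andPair b c)) c C)
  -- implication
  | impLam {n : ℕ} {Γ : Ctx n} {B C : Expr n} {c : Expr (n + 1)} :
      Derivable Γ (.type .prop B) → Derivable Γ (.type .prop C) →
      Derivable (Γ.snoc B) (.tm c C.wk) →
      Derivable Γ (.tm (.impLam B c) (.imp B C))
  | impApp {n : ℕ} {Γ : Ctx n} {B C f b : Expr n} :
      Derivable Γ (.tm f (.imp B C)) → Derivable Γ (.tm b B) →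
      Derivable Γ (.tm (.impApp f b) C)
  | impApp_lam {n : ℕ} {Γ : Ctx n} {B C b : Expr n} {c : Expr (n + 1)} :
      Derivable Γ (.type .prop B) → Derivable Γ (.type .prop C) →
      Derivable (Γ.snoc B) (.tm c C.wk) → Derivable Γ (.tm b B) →
      Derivable Γ (.tmEq (.impApp (.impLam B c) b) (c.inst b) C)
  -- existential quantification
  | exPair {n : ℕ} {Γ : Ctx n} {B b c : Expr n} {C : Expr (n + 1)} :
      Derivable (Γ.snoc B) (.type .prop C) →
      Derivable Γ (.tm b B) → Derivable Γ (.tm c (C.inst b)) →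
      Derivable Γ (.tm (.exPair b c) (.ex B C))
  | elEx {n : ℕ} {Γ : Ctx n} {B A d : Expr n} {C : Expr (n + 1)} {m : Expr (n + 2)} :
      Derivable Γ (.type .prop A) → Derivable Γ (.tm d (.ex B C)) →
      Derivable ((Γ.snoc B).snoc C) (.tm m A.wk.wk) →
      Derivable Γ (.tm (.elEx d m) A)
  | elEx_pair {n : ℕ} {Γ : Ctx n} {B A b c : Expr n} {C : Expr (n + 1)} {m : Expr (n + 2)} :
      Derivable Γ (.type .prop A) → Derivable (Γ.snoc B) (.type .prop C) →
      Derivable Γ (.tm b B) → Derivable Γ (.tm c (C.inst b)) →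
      Derivable ((Γ.snoc B).snoc C) (.tm m A.wk.wk) →
      Derivable Γ (.tmEq (.elEx (.exPair b c) m) (m.inst₂ b c) A)
  -- universal quantification
  | allLam {n : ℕ} {Γ : Ctx n} {B : Expr n} {C c : Expr (n + 1)} :
      Derivable (Γ.snoc B) (.type .prop C) → Derivable (Γ.snoc B) (.tm c C) →
      Derivable Γ (.tm (.allLam B c) (.all B C))
  | allApp {n : ℕ} {Γ : Ctx n} {B f b : Expr n} {C : Expr (n + 1)} :
      Derivable Γ (.tm f (.all B C)) → Derivable Γ (.tm b B) →
      Derivable Γ (.tm (.allApp f b) (C.inst b))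
  | allApp_lam {n : ℕ} {Γ : Ctx n} {B b : Expr n} {C c : Expr (n + 1)} :
      Derivable (Γ.snoc B) (.type .prop C) → Derivable (Γ.snoc B) (.tm c C) →
      Derivable Γ (.tm b B) →
      Derivable Γ (.tmEq (.allApp (.allLam B c) b) (c.inst b) (C.inst b))
  -- propositional equality
  | idRefl {n : ℕ} {Γ : Ctx n} {A a : Expr n} :
      Derivable Γ (.type .col A) → Derivable Γ (.tm a A) →
      Derivable Γ (.tm (.idRefl A a) (.id A a a))
  | elId {n : ℕ} {Γ : Ctx n} {A a b p : Expr n} {C : Expr (n + 2)} {c : Expr (n + 1)} :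
      Derivable ((Γ.snoc A).snoc A.wk) (.type .prop C) →
      Derivable Γ (.tm a A) → Derivable Γ (.tm b A) → Derivable Γ (.tm p (.id A a b)) →
      Derivable (Γ.snoc A) (.tm c (C.inst (.var 0))) →
      Derivable Γ (.tm (.elId p c) (C.inst₂ a b))
  | elId_refl {n : ℕ} {Γ : Ctx n} {A a : Expr n} {C : Expr (n + 2)} {c : Expr (n + 1)} :
      Derivable ((Γ.snoc A).snoc A.wk) (.type .prop C) → Derivable Γ (.tm a A) →
      Derivable (Γ.snoc A) (.tm c (C.inst (.var 0))) →
      Derivable Γ (.tmEq (.elId (.idRefl A a) c) (c.inst a) (C.inst₂ a a))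

/-! ### Derived rules needed for the syntactic categories and doctrines -/

/-- The context `[x ∈ A]` for a closed type `A`. -/
abbrev Ctx.one (A : Expr 0) : Ctx 1 := Ctx.nil.snoc A

theorem Expr.subst_wk {n m : ℕ} (σ : Fin (n + 1) → Expr m) (e : Expr n) :
    e.wk.subst σ = e.subst (fun i => σ i.succ) := Expr.subst_ren _ _ _

theorem Expr.wk_subst_up {n m : ℕ} (σ : Fin n → Expr m) (e : Expr n) :
    e.wk.subst (Expr.up σ) = (e.subst σ).wk := by
  rw [Expr.subst_wk, Expr.wk, Expr.ren_subst]; rfl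

theorem Expr.wk_inst {n : ℕ} (e b : Expr n) : e.wk.inst b = e := by
  rw [Expr.inst, Expr.subst_wk]; exact Expr.subst_var e

theorem Expr.closed_subst {m : ℕ} (B : Expr 0) (σ τ : Fin 0 → Expr m) : B.subst σ = B.subst τ := by
  congr 1; funext i; exact i.elim0

theorem Expr.subst_closed {n m : ℕ} (σ : Fin (n + 1) → Expr m) (ρ : Fin 0 → Fin (n + 1))
    (τ : Fin 0 → Fin m) (B : Expr 0) : (B.ren ρ).subst σ = B.ren τ := by
  rw [Expr.subst_ren, Expr.ren_eq_subst]; exact B.closed_subst _ _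

theorem Derivable.cast {n : ℕ} {Γ : Ctx n} {J J' : Judgment n} (h : Derivable Γ J) (e : J = J') :
    Derivable Γ J' := e ▸ h

theorem Derivable.tm_cast {n : ℕ} {Γ : Ctx n} {a a' A A' : Expr n} (h : Derivable Γ (.tm a A))
    (e : a = a') (e' : A = A') : Derivable Γ (.tm a' A') := e ▸ e' ▸ h

/-- Weakening. -/
theorem Derivable.weaken {n : ℕ} {Γ : Ctx n} {J : Judgment n} {A : Expr n} (h : Derivable Γ J)
    (hA : Derivable Γ (.type .col A)) :
    Derivable (Γ.snoc A) (J.subst (fun i => .var i.succ)) := by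
  refine .subst _ h (.ctx_snoc hA) (fun i => ?_)
  have := Derivable.var (Γ := Γ.snoc A) i.succ (.ctx_snoc hA)
  exact this.tm_cast rfl (Expr.ren_eq_subst _ _)

theorem Derivable.weaken_type {n : ℕ} {Γ : Ctx n} {A B : Expr n} {K : Kind}
    (h : Derivable Γ (.type K B)) (hA : Derivable Γ (.type .col A)) :
    Derivable (Γ.snoc A) (.type K B.wk) :=
  (h.weaken hA).cast (by simp [Judgment.subst, Expr.wk, Expr.ren_eq_subst])

theorem Derivable.weaken_tm {n : ℕ} {Γ : Ctx n} {A B b : Expr n}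
    (h : Derivable Γ (.tm b B)) (hA : Derivable Γ (.type .col A)) :
    Derivable (Γ.snoc A) (.tm b.wk B.wk) :=
  (h.weaken hA).cast (by simp [Judgment.subst, Expr.wk, Expr.ren_eq_subst])

/-- Substitution under one more declaration. -/
theorem Derivable.subst_up {n m : ℕ} {Γ : Ctx n} {Δ : Ctx m} {A : Expr n} {J : Judgment (n + 1)}
    {σ : Fin n → Expr m} (h : Derivable (Γ.snoc A) J)
    (hσ : ∀ i, Derivable Δ (.tm (σ i) ((Γ.get i).subst σ)))
    (hA : Derivable Δ (.type .col (A.subst σ))) :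
    Derivable (Δ.snoc (A.subst σ)) (J.subst (Expr.up σ)) := by
  refine .subst _ h (.ctx_snoc hA) (fun i => ?_)
  refine Fin.cases ?_ (fun i => ?_) i
  · exact (Derivable.var (0 : Fin (m + 1)) (.ctx_snoc hA)).tm_cast rfl
      (Expr.wk_subst_up σ A).symm
  · exact ((hσ i).weaken_tm hA).tm_cast rfl (Expr.wk_subst_up σ _).symm

/-- Substitution of the last variable. -/
theorem Derivable.inst {n : ℕ} {Γ : Ctx n} {A a : Expr n} {J : Judgment (n + 1)}
    (h : Derivable (Γ.snoc A) J) (hΓ : Derivable Γ .ctx) (ha : Derivable Γ (.tm a A)) :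
    Derivable Γ (J.subst (Expr.scons a .var)) := by
  refine .subst _ h hΓ (fun i => ?_)
  refine Fin.cases ?_ (fun i => ?_) i
  · exact ha.tm_cast rfl (Expr.wk_inst A a).symm
  · exact (Derivable.var i hΓ).tm_cast rfl (Expr.wk_inst _ a).symm

/-- Propositions that depend on `x ∈ A` respect propositional equality on `A`. -/
theorem Derivable.leibniz {n : ℕ} {Γ : Ctx n} {A a b p q : Expr n} {φ : Expr (n + 1)}
    (hA : Derivable Γ (.type .col A))
    (ha : Derivable Γ (.tm a A)) (hb : Derivable Γ (.tm b A))
    (hp : Derivable Γ (.tm p (.id A a b)))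
    (hφ : Derivable (Γ.snoc A) (.type .prop φ)) (hq : Derivable Γ (.tm q (φ.inst a))) :
    ∃ r, Derivable Γ (.tm r (φ.inst b)) := by
  have hA' : Derivable (Γ.snoc A) (.type .col A.wk) := hA.weaken_type hA
  have h1 : Derivable ((Γ.snoc A).snoc A.wk) (.type .prop φ.wk) := hφ.weaken_type hA'
  have h2 : Derivable ((Γ.snoc A).snoc A.wk)
      (.type .prop (φ.subst (Expr.up (fun i => .var i.succ)))) := by
    have e : A.wk = A.subst (fun i => .var i.succ) := Expr.ren_eq_subst _ _
    rw [e] at hA' ⊢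
    refine (hφ.subst_up (Δ := Γ.snoc A) (fun i => ?_) hA' :)
    exact (Derivable.var (Γ := Γ.snoc A) i.succ (.ctx_snoc hA)).tm_cast rfl
      (Expr.ren_eq_subst _ _)
  have hrefl : Derivable (Γ.snoc A) (.tm (.impLam φ (.var 0)) (.imp φ φ)) :=
    .impLam hφ hφ (Derivable.var (Γ := (Γ.snoc A).snoc φ) 0 (.ctx_snoc (.prop_col hφ)))
  have e1 : ((Expr.imp φ.wk (φ.subst (Expr.up (fun i => .var i.succ)))).inst (.var 0)) =
      .imp φ φ := by
    simp only [Expr.inst, Expr.subst, Expr.imp.injEq]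
    refine ⟨Expr.wk_inst _ _, ?_⟩
    rw [Expr.subst_subst]
    conv_rhs => rw [← Expr.subst_var φ]
    congr 1; funext i; refine Fin.cases rfl (fun i => rfl) i
  have h3 := Derivable.elId (.imp_prop h1 h2) ha hb hp (hrefl.tm_cast rfl e1.symm)
  refine ⟨_, Derivable.impApp (h3.tm_cast rfl (A' := .imp (φ.inst a) (φ.inst b)) ?_) hq⟩
  simp only [Expr.inst₂, Expr.inst, Expr.subst, Expr.imp.injEq]
  constructor
  · rw [Expr.subst_wk]; rfl
  · rw [Expr.subst_subst]
    congr 1; funext i; refine Fin.cases rfl (fun i => rfl) i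

theorem Derivable.id_symm {n : ℕ} {Γ : Ctx n} {A a b p : Expr n}
    (hA : Derivable Γ (.type .col A))
    (ha : Derivable Γ (.tm a A)) (hb : Derivable Γ (.tm b A))
    (hp : Derivable Γ (.tm p (.id A a b))) : ∃ r, Derivable Γ (.tm r (.id A b a)) := by
  have := Derivable.leibniz (φ := .id A.wk (.var 0) a.wk) (q := .idRefl A a) hA ha hb hp
    (.id_prop (hA.weaken_type hA) (.var (Γ := Γ.snoc A) 0 (.ctx_snoc hA)) (ha.weaken_tm hA))
    ((Derivable.idRefl hA ha).tm_cast rfl (by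
      simp only [Expr.inst, Expr.subst]
      exact congrArg₂ (Expr.id · a ·) (A.wk_inst a).symm (a.wk_inst a).symm))
  obtain ⟨r, hr⟩ := this
  refine ⟨r, hr.tm_cast rfl ?_⟩
  simp only [Expr.inst, Expr.subst]
  exact congrArg₂ (Expr.id · b ·) (A.wk_inst b) (a.wk_inst b)

theorem Derivable.id_trans {n : ℕ} {Γ : Ctx n} {A a b c p q : Expr n}
    (hA : Derivable Γ (.type .col A))
    (ha : Derivable Γ (.tm a A)) (hb : Derivable Γ (.tm b A)) (hc : Derivable Γ (.tm c A))
    (hp : Derivable Γ (.tm p (.id A a b))) (hq : Derivable Γ (.tm q (.id A b c))) :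
    ∃ r, Derivable Γ (.tm r (.id A a c)) := by
  have := Derivable.leibniz (φ := .id A.wk a.wk (.var 0)) (q := p) hA hb hc hq
    (.id_prop (hA.weaken_type hA) (ha.weaken_tm hA) (.var (Γ := Γ.snoc A) 0 (.ctx_snoc hA)))
    (hp.tm_cast rfl (by
      simp only [Expr.inst, Expr.subst]
      exact congrArg₂ (Expr.id · · b) (A.wk_inst b).symm (a.wk_inst b).symm))
  obtain ⟨r, hr⟩ := this
  refine ⟨r, hr.tm_cast rfl ?_⟩
  simp only [Expr.inst, Expr.subst]
  exact congrArg₂ (Expr.id · · c) (A.wk_inst c) (a.wk_inst c)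

/-! ### The syntactic category of collections -/

/-- Closed collections of `mtt`. -/
structure CM : Type where
  carrier : Expr 0
  isCol : Derivable .nil (.type .col carrier)

namespace CM

/-- The context `[x ∈ A]`. -/
abbrev ctx (A : CM) : Ctx 1 := Ctx.one A.carrier

theorem ctx_ok (A : CM) : Derivable A.ctx .ctx := .ctx_snoc A.isCol

theorem col_wk (A B : CM) : Derivable A.ctx (.type .col B.carrier.wk) := B.isCol.weaken_type A.isCol

theorem wk_subst {m : ℕ} (B : Expr 0) (σ : Fin 1 → Expr (m + 1)) :
    B.wk.subst σ = B.ren Fin.elim0 :=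
  Expr.subst_closed _ _ _ _

theorem wk_subst_one (B : Expr 0) (σ : Fin 1 → Expr 1) : B.wk.subst σ = B.wk :=
  Expr.subst_closed _ _ _ _

/-- Terms `t ∈ B [x ∈ A]`. -/
def Term (A B : CM) : Type := {t : Expr 1 // Derivable A.ctx (.tm t B.carrier.wk)}

/-- Substitution of a term `t ∈ B [x ∈ A]` in a judgement in the context `[y ∈ B]`. -/
theorem subst_one {A B : CM} {J : Judgment 1} (h : Derivable B.ctx J) (t : Term A B) :
    Derivable A.ctx (J.subst (fun _ => t.1)) := by
  refine .subst _ h A.ctx_ok (fun i => ?_)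
  refine Fin.cases ?_ (fun i => i.elim0) i
  exact t.2.tm_cast rfl (wk_subst_one _ _).symm

/-- Terms `t, t' ∈ B [x ∈ A]` are equivalent if there is a proof-term
`p ∈ Id(B, t, t') [x ∈ A]`. -/
def Term.setoid (A B : CM) : Setoid (Term A B) where
  r t t' := ∃ p, Derivable A.ctx (.tm p (.id B.carrier.wk t.1 t'.1))
  iseqv :=
    { refl := fun t => ⟨_, .idRefl (A.col_wk B) t.2⟩
      symm := fun {t t'} ⟨_, h⟩ => Derivable.id_symm (A.col_wk B) t.2 t'.2 h
      trans := fun {t t' t''} ⟨_, h⟩ ⟨_, h'⟩ =>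
        Derivable.id_trans (A.col_wk B) t.2 t'.2 t''.2 h h' }

/-- Arrows `A → B`: equivalence classes of terms `t ∈ B [x ∈ A]`. -/
def Hom (A B : CM) : Type := Quotient (Term.setoid A B)

/-- The term `x ∈ A [x ∈ A]`. -/
def Term.ident (A : CM) : Term A A := ⟨.var 0, Derivable.var (Γ := A.ctx) 0 A.ctx_ok⟩

/-- The term `s(t) ∈ C [x ∈ A]`. -/
def Term.comp {A B C : CM} (t : Term A B) (s : Term B C) : Term A C :=
  ⟨s.1.subst (fun _ => t.1), (subst_one s.2 t).tm_cast rfl (wk_subst_one _ _)⟩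

/-- Weakening of a judgement in the context `[y ∈ B]` to the context `[x ∈ A, y ∈ B]`. -/
theorem subst_last {A B : CM} {J : Judgment 1} (h : Derivable B.ctx J) :
    Derivable (A.ctx.snoc B.carrier.wk) (J.subst (fun _ => .var 0)) := by
  have hc : Derivable (A.ctx.snoc B.carrier.wk) .ctx := .ctx_snoc (A.col_wk B)
  refine .subst _ h hc (fun i => ?_)
  refine Fin.cases ?_ (fun i => i.elim0) i
  refine (Derivable.var (Γ := A.ctx.snoc B.carrier.wk) 0 hc).tm_cast rfl ?_
  refine Eq.trans ?_ (wk_subst _ _).symm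
  change Expr.ren _ (Expr.ren _ _) = _
  rw [Expr.ren_ren]; congr 1; funext i; exact i.elim0

theorem comp_congr {A B C : CM} {t t' : Term A B} {s s' : Term B C}
    (h : (Term.setoid A B).r t t') (h' : (Term.setoid B C).r s s') :
    (Term.setoid A C).r (t.comp s) (t'.comp s') := by
  obtain ⟨p, hp⟩ := h
  obtain ⟨q, hq⟩ := h'
  have h1 : (Term.setoid A C).r (t.comp s) (t.comp s') :=
    ⟨_, (subst_one hq t).tm_cast rfl (by
      simp only [Expr.subst, wk_subst_one]; rfl)⟩
  refine (Term.setoid A C).iseqv.trans h1 ?_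
  have hAB := A.col_wk B
  have e2 : C.carrier.wk.subst (fun _ => Expr.var 0) = (C.carrier.wk.wk : Expr 2) := by
    refine (wk_subst _ _).trans ?_
    change _ = Expr.ren _ (Expr.ren _ _)
    rw [Expr.ren_ren]; congr 1; funext i; exact i.elim0
  have key := Derivable.leibniz (A := B.carrier.wk) (a := t.1) (b := t'.1) (p := p)
    (φ := .id C.carrier.wk.wk (t.comp s').1.wk (s'.1.subst (fun _ => .var 0)))
    (q := .idRefl C.carrier.wk (t.comp s').1) hAB t.2 t'.2 hp
    (.id_prop ((A.col_wk C).weaken_type hAB) ((t.comp s').2.weaken_tm hAB)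
      ((subst_last s'.2).tm_cast rfl e2))
    ((Derivable.idRefl (A.col_wk C) (t.comp s').2).tm_cast rfl (by
      simp only [Expr.inst, Expr.subst, Expr.subst_subst, Expr.id.injEq]
      exact ⟨(Expr.wk_inst _ _).symm, (Expr.wk_inst _ _).symm, rfl⟩))
  obtain ⟨r, hr⟩ := key
  refine ⟨r, hr.tm_cast rfl ?_⟩
  simp only [Expr.inst, Expr.subst, Expr.subst_subst, Expr.id.injEq]
  exact ⟨Expr.wk_inst _ _, Expr.wk_inst _ _, rfl⟩

theorem Term.ext {A B : CM} {t s : Term A B} (h : t.1 = s.1) : t = s := Subtype.ext h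

/-- The syntactic category of collections in `mtt`. -/
instance : Category CM where
  Hom A B := Hom A B
  id A := Quotient.mk (Term.setoid A A) (Term.ident A)
  comp {A B C} f g := Quotient.map₂ (sa := Term.setoid A B) (sb := Term.setoid B C)
    (sc := Term.setoid A C) Term.comp (fun _ _ h _ _ h' => comp_congr h h') f g
  id_comp {A B} f := by
    induction f using Quotient.inductionOn with | _ t => ?_
    refine congrArg (Quotient.mk (Term.setoid A B)) (Term.ext ?_)
    refine Eq.trans ?_ (Expr.subst_var t.1)
    change Expr.subst _ _ = _
    congr 1; funext i; refine Fin.cases rfl (fun i => i.elim0) i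
  comp_id {A B} f := by
    induction f using Quotient.inductionOn with | _ t => ?_
    exact congrArg (Quotient.mk (Term.setoid A B)) (Term.ext rfl)
  assoc {A B C D} f g h := by
    induction f using Quotient.inductionOn with | _ t => ?_
    induction g using Quotient.inductionOn with | _ s => ?_
    induction h using Quotient.inductionOn with | _ r => ?_
    refine congrArg (Quotient.mk (Term.setoid A D)) (Term.ext ?_)
    exact (Expr.subst_subst _ _ _).symm

/-- The arrow represented by a term. -/
def homMk {A B : CM} (t : Term A B) : A ⟶ B := Quotient.mk (Term.setoid A B) t

end CM

/-- The syntactic category of sets in `mtt`: the full subcategory of `CM` on the closed sets. -/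
abbrev SM : Type :=
  ObjectProperty.FullSubcategory (fun A : CM => Derivable .nil (.type .set A.carrier))

/-! ### The doctrines -/

/-- `prop` or, if `small`, `props`. -/
def Kind.logical (small : Bool) : Kind := if small then .props else .prop

/-- Propositions (small propositions if `small`) depending on `x ∈ A`. -/
def Pred (small : Bool) (A : CM) : Type :=
  {φ : Expr 1 // Derivable A.ctx (.type (.logical small) φ)}

namespace Pred

theorem isProp {small : Bool} {A : CM} (φ : Pred small A) : Derivable A.ctx (.type .prop φ.1) := by
  obtain ⟨φ, h⟩ := φ
  cases small
  · exact h
  · exact .props_prop h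

theorem isCol {small : Bool} {A : CM} (φ : Pred small A) : Derivable A.ctx (.type .col φ.1) :=
  .prop_col φ.isProp

/-- `φ ≤ ψ` if there is a proof-term `r ∈ ψ [x ∈ A, w ∈ φ]`. -/
instance (small : Bool) (A : CM) : Preorder (Pred small A) where
  le φ ψ := ∃ r, Derivable (A.ctx.snoc φ.1) (.tm r ψ.1.wk)
  le_refl φ := ⟨.var 0, .var (Γ := A.ctx.snoc φ.1) 0 (.ctx_snoc φ.isCol)⟩
  le_trans φ ψ χ := by
    rintro ⟨r, hr⟩ ⟨s, hs⟩
    have hc : Derivable (A.ctx.snoc φ.1) .ctx := .ctx_snoc φ.isCol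
    have h := Derivable.subst (Γ := A.ctx.snoc ψ.1) (Δ := A.ctx.snoc φ.1)
      (Expr.scons r (fun i => .var i.succ)) hs hc (fun i => by
        refine Fin.cases ?_ (fun i => ?_) i
        · exact hr.tm_cast rfl ((Expr.ren_eq_subst _ _).trans
            (Expr.subst_wk (Expr.scons r (fun i => .var i.succ)) ψ.1).symm)
        · exact (Derivable.var (Γ := A.ctx.snoc φ.1) i.succ hc).tm_cast rfl
            ((Expr.ren_eq_subst _ _).trans
              (Expr.subst_wk (Expr.scons r (fun i => .var i.succ)) (A.ctx.get i)).symm))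
    exact ⟨_, h.tm_cast rfl ((Expr.subst_wk _ _).trans (Expr.ren_eq_subst _ _).symm)⟩

/-- The true proposition `⊥ → ⊥`. -/
def tt (small : Bool) (A : CM) : Pred small A :=
  ⟨.imp .fls .fls, by
    cases small
    · exact .imp_prop (.fls_prop A.ctx_ok) (.fls_prop A.ctx_ok)
    · exact .imp_props (.fls_props A.ctx_ok) (.fls_props A.ctx_ok)⟩

/-- The conjunction `φ ∧ ψ`. -/
def conj {small : Bool} {A : CM} (φ ψ : Pred small A) : Pred small A :=
  ⟨.and φ.1 ψ.1, by
    obtain ⟨φ, h⟩ := φ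
    obtain ⟨ψ, h'⟩ := ψ
    cases small
    · exact .and_prop h h'
    · exact .and_props h h'⟩

theorem le_tt {small : Bool} {A : CM} (φ : Pred small A) : φ ≤ tt small A := by
  have hc : Derivable (A.ctx.snoc φ.1) .ctx := .ctx_snoc φ.isCol
  have hf := Derivable.fls_prop hc
  exact ⟨_, .impLam hf hf (.var (Γ := (A.ctx.snoc φ.1).snoc .fls) 0 (.ctx_snoc (.prop_col hf)))⟩

theorem conj_le_left {small : Bool} {A : CM} (φ ψ : Pred small A) : conj φ ψ ≤ φ :=
  ⟨_, .andFst (.var (Γ := A.ctx.snoc (conj φ ψ).1) 0 (.ctx_snoc (conj φ ψ).isCol))⟩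

theorem conj_le_right {small : Bool} {A : CM} (φ ψ : Pred small A) : conj φ ψ ≤ ψ :=
  ⟨_, .andSnd (.var (Γ := A.ctx.snoc (conj φ ψ).1) 0 (.ctx_snoc (conj φ ψ).isCol))⟩

theorem le_conj {small : Bool} {A : CM} {χ φ ψ : Pred small A} (h : χ ≤ φ) (h' : χ ≤ ψ) :
    χ ≤ conj φ ψ := by
  obtain ⟨r, hr⟩ := h
  obtain ⟨s, hs⟩ := h'
  exact ⟨_, .andPair (φ.isProp.weaken_type χ.isCol) (ψ.isProp.weaken_type χ.isCol) hr hs⟩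

/-- Substitution of a term in a predicate. -/
def sub {small : Bool} {A B : CM} (t : CM.Term A B) (φ : Pred small B) : Pred small A :=
  ⟨φ.1.subst (fun _ => t.1), CM.subst_one φ.2 t⟩

theorem sub_mono {small : Bool} {A B : CM} (t : CM.Term A B) {φ ψ : Pred small B} (h : φ ≤ ψ) :
    sub t φ ≤ sub t ψ := by
  obtain ⟨r, hr⟩ := h
  have := Derivable.subst_up (σ := fun _ => t.1) hr (Δ := A.ctx) (fun i => by
    refine Fin.cases ?_ (fun i => i.elim0) i
    exact t.2.tm_cast rfl (CM.wk_subst_one _ _).symm) (sub t φ).isCol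
  exact ⟨_, this.tm_cast rfl (Expr.wk_subst_up _ _)⟩

theorem sub_congr {small : Bool} {A B : CM} {t t' : CM.Term A B}
    (h : (CM.Term.setoid A B).r t t') (φ : Pred small B) : sub t φ ≤ sub t' φ := by
  obtain ⟨p, hp⟩ := h
  have hAB := A.col_wk B
  have h1 := (sub t φ).isProp
  have key := Derivable.leibniz (A := B.carrier.wk) (a := t.1) (b := t'.1) (p := p)
    (φ := .imp (sub t φ).1.wk (φ.1.subst (fun _ => .var 0)))
    (q := .impLam (sub t φ).1 (.var 0)) hAB t.2 t'.2 hp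
    (.imp_prop (h1.weaken_type hAB) (CM.subst_last φ.isProp))
    ((Derivable.impLam h1 h1 (.var (Γ := A.ctx.snoc (sub t φ).1) 0
      (.ctx_snoc (sub t φ).isCol))).tm_cast rfl (by
        simp only [Expr.inst, Expr.subst, Expr.subst_subst, Expr.imp.injEq]
        exact ⟨(Expr.wk_inst _ _).symm, rfl⟩))
  obtain ⟨r, hr⟩ := key
  have hr' : Derivable A.ctx (.tm r (.imp (sub t φ).1 (sub t' φ).1)) := hr.tm_cast rfl (by
    simp only [Expr.inst, Expr.subst, Expr.subst_subst, Expr.imp.injEq]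
    exact ⟨Expr.wk_inst _ _, rfl⟩)
  exact ⟨_, .impApp (hr'.weaken_tm (sub t φ).isCol)
    (.var (Γ := A.ctx.snoc (sub t φ).1) 0 (.ctx_snoc (sub t φ).isCol))⟩

/-- The order of predicates modulo equiprovability: `φ` and `ψ` are identified if `φ ≤ ψ` and
`ψ ≤ φ`. -/
abbrev Class (small : Bool) (A : CM) : Type := Antisymmetrization (Pred small A) (· ≤ ·)

/-- Identified predicates are those for which `φ ↔ ψ` has a proof. -/
theorem class_eq_iff {small : Bool} {A : CM} (φ ψ : Pred small A) :
    (toAntisymmetrization (· ≤ ·) φ : Class small A) = toAntisymmetrization (· ≤ ·) ψ ↔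
      ∃ p, Derivable A.ctx (.tm p (.and (.imp φ.1 ψ.1) (.imp ψ.1 φ.1))) := by
  have mp : ∀ {f : Expr 1} {φ ψ : Pred small A},
      Derivable A.ctx (.tm f (.imp φ.1 ψ.1)) → φ ≤ ψ := fun {f φ ψ} h =>
    ⟨_, .impApp (h.weaken_tm φ.isCol) (.var (Γ := A.ctx.snoc φ.1) 0 (.ctx_snoc φ.isCol))⟩
  constructor
  · intro h
    obtain ⟨⟨r, hr⟩, ⟨s, hs⟩⟩ := Quotient.exact h
    exact ⟨_, .andPair (.imp_prop φ.isProp ψ.isProp) (.imp_prop ψ.isProp φ.isProp)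
      (.impLam φ.isProp ψ.isProp hr) (.impLam ψ.isProp φ.isProp hs)⟩
  · rintro ⟨p, hp⟩
    exact Quotient.sound ⟨mp (.andFst hp), mp (.andSnd hp)⟩

instance (small : Bool) (A : CM) : SemilatticeInf (Class small A) where
  inf := Quotient.map₂ (sa := AntisymmRel.setoid (Pred small A) (· ≤ ·))
    (sb := AntisymmRel.setoid (Pred small A) (· ≤ ·))
    (sc := AntisymmRel.setoid (Pred small A) (· ≤ ·)) conj (fun _ _ h _ _ h' =>
    ⟨le_conj ((conj_le_left _ _).trans h.1) ((conj_le_right _ _).trans h'.1),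
      le_conj ((conj_le_left _ _).trans h.2) ((conj_le_right _ _).trans h'.2)⟩)
  inf_le_left a b := Quotient.inductionOn₂ a b (fun φ ψ => conj_le_left φ ψ)
  inf_le_right a b := Quotient.inductionOn₂ a b (fun φ ψ => conj_le_right φ ψ)
  le_inf a b c := Quotient.inductionOn₃ a b c (fun _ _ _ h h' => le_conj h h')

instance (small : Bool) (A : CM) : OrderTop (Class small A) where
  top := toAntisymmetrization (· ≤ ·) (tt small A)
  le_top a := Quotient.inductionOn a le_tt

/-- The action of an arrow of `CM` on classes of predicates, given by substitution. -/
def act {small : Bool} {A B : CM} (f : A ⟶ B) (α : Class small B) : Class small A :=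
  Quotient.map₂ (sa := CM.Term.setoid A B)
    (sb := AntisymmRel.setoid (Pred small B) (· ≤ ·))
    (sc := AntisymmRel.setoid (Pred small A) (· ≤ ·)) sub
    (fun t t' h _ _ h' => ⟨(sub_mono t h'.1).trans (sub_congr h _),
      (sub_mono t' h'.2).trans (sub_congr ((CM.Term.setoid A B).iseqv.symm h) _)⟩) f α

theorem act_id {small : Bool} {A : CM} (α : Class small A) : act (𝟙 A) α = α := by
  induction α using Quotient.inductionOn with | _ φ => ?_
  refine congrArg (toAntisymmetrization (α := Pred small A) (· ≤ ·)) (Subtype.ext ?_)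
  refine Eq.trans ?_ (Expr.subst_var φ.1)
  change Expr.subst _ _ = _
  congr 1; funext i; refine Fin.cases rfl (fun i => i.elim0) i

theorem act_comp {small : Bool} {A B C : CM} (f : A ⟶ B) (g : B ⟶ C) (α : Class small C) :
    act (f ≫ g) α = act f (act g α) := by
  refine Quotient.inductionOn₃ (s₁ := CM.Term.setoid A B) (s₂ := CM.Term.setoid B C)
    f g α (fun t s φ => ?_)
  refine congrArg (toAntisymmetrization (α := Pred small A) (· ≤ ·)) (Subtype.ext ?_)
  exact (Expr.subst_subst _ _ _).symm

/-- `A ↦` (small) propositions depending on `x ∈ A`, modulo equiprovability. -/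
def doctrine (small : Bool) : CMᵒᵖ ⥤ SemilatInfCat.{0} where
  obj A := .of (Class small A.unop)
  map {B A} f :=
    { toFun := act f.unop
      map_inf' := fun a b => by
        refine Quotient.inductionOn₃ (s₁ := CM.Term.setoid A.unop B.unop) f.unop a b
          (fun t φ ψ => rfl)
      map_top' := Quotient.inductionOn (s := CM.Term.setoid A.unop B.unop) f.unop (fun t => rfl) }
  map_id A := DFunLike.ext (F := InfTopHom _ _) _ _ (fun α => act_id α)
  map_comp g f := DFunLike.ext (F := InfTopHom _ _) _ _ (fun α => act_comp f.unop g.unop α)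

end Pred

/-- The doctrine of propositions on closed collections. -/
def F : CMᵒᵖ ⥤ SemilatInfCat.{0} := Pred.doctrine false

/-- The doctrine of small propositions on closed sets. -/
def G : SMᵒᵖ ⥤ SemilatInfCat.{0} := (ObjectProperty.ι _).op ⋙ Pred.doctrine true

end MTT

/-! The argument separates a categorical half from a syntactic one, with `IsFirstOrder` as the
interface between them.

Categorically, an arrow `h : T ⟶ A` is treated as a generalized element of `A`, and `Forces P h α`
says that this element satisfies `α`. A full weak comprehension of `α` is a generic element
satisfying `α`, so the order of each fibre is determined by forcing (`IsFirstOrder.le_iff`).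
Together with equality, implication and quantifiers over objects, this gives adjoints along every
arrow `f : X ⟶ A`, not only along projections and diagonals: the left adjoint sends `β` to `∃ x, f x
= a ∧ β x`, the right adjoint to `∀ x, f x = a → β x` (`exists_along`, `forall_along`). Their
universal properties are stated after an arbitrary substitution into `A`, and this contains the
Beck–Chevalley conditions; Frobenius reciprocity follows from implication. The diagonal is a weak
comprehension of its equality predicate because to force equality of two arrows is to make them
equal.

Syntactically, the object `Σ A C` does most of the work. Its projections satisfy the β-rules
definitionally, and η holds propositionally (`sigma_eta`), which suffices because arrows are terms
modulo propositional equality. For constant `C` this gives binary products; for a proposition `C` it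
gives the comprehension, since propositions are collections. `Derivable.of_proj` passes from a proof
over an element of a sum to a proof over two variables, and from it come fullness and the quantifier
rules that concern `Y × X`. Connectives and quantifiers commute with substitution on the nose, so
stability costs nothing.

For sets the same constructions stay inside sets and small propositions. Weak exponentials are
Π-types: the β-rule makes the evaluation triangle commute, and only existence of a transpose is
asked, so the missing ξ-rule does no harm. -/

namespace Doctrine

universe w v u

/-! ### Forcing: predicates satisfied by generalized elements. -/

section Pull

variable {C : Type u} [Category.{v} C] (P : Cᵒᵖ ⥤ SemilatInfCat.{w})

theorem pull_id {A : C} (α : P.obj (op A)) : pull P (𝟙 A) α = α := by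
  simp [pull]

theorem pull_comp {A B D : C} (f : A ⟶ B) (g : B ⟶ D) (α : P.obj (op D)) :
    pull P (f ≫ g) α = pull P f (pull P g α) := by
  simp [pull]

theorem pull_inf {A B : C} (f : A ⟶ B) (α β : P.obj (op B)) :
    pull P f (α ⊓ β) = pull P f α ⊓ pull P f β :=
  map_inf (ConcreteCategory.hom (P.map f.op)) α β

theorem pull_top {A B : C} (f : A ⟶ B) : pull P f ⊤ = ⊤ :=
  map_top (ConcreteCategory.hom (P.map f.op))

theorem pull_mono {A B : C} (f : A ⟶ B) : Monotone (pull P f) := fun α β h => by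
  rw [← inf_eq_left] at h ⊢
  rw [← pull_inf, h]

/-- The arrow `h` forces `α` if `⊤ ≤ P_h(α)`. -/
def Forces {T A : C} (h : T ⟶ A) (α : P.obj (op A)) : Prop := ⊤ ≤ pull P h α

variable {P}

theorem forces_comp {S T A : C} {h : S ⟶ T} {k : T ⟶ A} {α : P.obj (op A)} :
    Forces P (h ≫ k) α ↔ Forces P h (pull P k α) := by
  rw [Forces, Forces, pull_comp]

theorem Forces.precomp {S T A : C} {h : T ⟶ A} {α : P.obj (op A)} (H : Forces P h α)
    (k : S ⟶ T) : Forces P (k ≫ h) α := by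
  rw [Forces, pull_comp, ← pull_top P k]
  exact pull_mono P k H

theorem Forces.mono {T A : C} {h : T ⟶ A} {α β : P.obj (op A)} (H : Forces P h α)
    (le : α ≤ β) : Forces P h β :=
  le_trans H (pull_mono P h le)

theorem forces_inf {T A : C} {h : T ⟶ A} {α β : P.obj (op A)} :
    Forces P h (α ⊓ β) ↔ Forces P h α ∧ Forces P h β := by
  rw [Forces, pull_inf, le_inf_iff]; rfl

theorem forces_top {T A : C} {h : T ⟶ A} : Forces P h ⊤ := (pull_top P h).ge

end Pull

/-! ### First-order doctrines and their adjoints along arbitrary arrows. -/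

/-- A doctrine which interprets intuitionistic first-order logic with equality, in a form that
refers to arbitrary arrows: `e` is the equality predicate of `f` and `g`, and `ε`, `υ` are the
quantifications of `φ` over `X`. -/
structure IsFirstOrder {C : Type u} [Category.{v} C] (P : Cᵒᵖ ⥤ SemilatInfCat.{w}) : Prop where
  comprehension : HasFullWeakComprehensions P
  imp {A : C} (α β : P.obj (op A)) : ∃ ι : P.obj (op A), ∀ {Y : C} (h : Y ⟶ A) (γ : P.obj (op Y)),
    γ ≤ pull P h ι ↔ pull P h α ⊓ γ ≤ pull P h β
  eq {Y A : C} (f g : Y ⟶ A) : ∃ e : P.obj (op Y), ∀ {T : C} (h : T ⟶ Y),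
    Forces P h e ↔ h ≫ f = h ≫ g
  quantifiers (A X : C) : ∃ (V : C) (p : V ⟶ A) (q : V ⟶ X),
    (∀ {T : C} (f : T ⟶ A) (g : T ⟶ X), ∃ v : T ⟶ V, v ≫ p = f ∧ v ≫ q = g) ∧
    ∀ φ : P.obj (op V),
      (∃ ε : P.obj (op A), ∀ {Y : C} (h : Y ⟶ A) (γ : P.obj (op Y)), pull P h ε ≤ γ ↔
        ∀ {T : C} (k : T ⟶ Y) (v : T ⟶ V), v ≫ p = k ≫ h → Forces P v φ → Forces P k γ) ∧
      (∃ υ : P.obj (op A), ∀ {Y : C} (h : Y ⟶ A), Forces P h υ ↔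
        ∀ {T : C} (k : T ⟶ Y) (v : T ⟶ V), v ≫ p = k ≫ h → Forces P v φ)

/-- A criterion in terms of chosen products: it suffices that the quantifiers satisfy their
introduction and elimination rules, the latter in the presence of a parameter `h`. -/
theorem IsFirstOrder.of_products {C : Type u} [Category.{v} C] {P : Cᵒᵖ ⥤ SemilatInfCat.{w}}
    (comprehension : HasFullWeakComprehensions P)
    (imp : ∀ {A : C} (α β : P.obj (op A)), ∃ ι : P.obj (op A), ∀ {Y : C} (h : Y ⟶ A)
      (γ : P.obj (op Y)), γ ≤ pull P h ι ↔ pull P h α ⊓ γ ≤ pull P h β)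
    (eq : ∀ {Y A : C} (f g : Y ⟶ A), ∃ e : P.obj (op Y), ∀ {T : C} (h : T ⟶ Y),
      Forces P h e ↔ h ≫ f = h ≫ g)
    {V : C → C → C} {p : ∀ A B, V A B ⟶ A} {q : ∀ A B, V A B ⟶ B}
    (hV : ∀ A B, IsLimit (BinaryFan.mk (p A B) (q A B)))
    (ex : ∀ {A X : C} (φ : P.obj (op (V A X))), ∃ ε : P.obj (op A),
      (∀ {T : C} (v : T ⟶ V A X), Forces P v φ → Forces P (v ≫ p A X) ε) ∧
      ∀ {Y : C} (h : Y ⟶ A) (v : V Y X ⟶ V A X) (γ : P.obj (op Y)), v ≫ p A X = p Y X ≫ h →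
        v ≫ q A X = q Y X → pull P v φ ≤ pull P (p Y X) γ → pull P h ε ≤ γ)
    (all : ∀ {A X : C} (φ : P.obj (op (V A X))), ∃ υ : P.obj (op A),
      (∀ {T : C} (v : T ⟶ V A X), Forces P (v ≫ p A X) υ → Forces P v φ) ∧
      ∀ {Y : C} (h : Y ⟶ A) (v : V Y X ⟶ V A X), v ≫ p A X = p Y X ≫ h →
        v ≫ q A X = q Y X → Forces P v φ → Forces P h υ) : IsFirstOrder P where
  comprehension := comprehension
  imp := imp
  eq := eq
  quantifiers A X := by
    have lift : ∀ {T B : C} (f : T ⟶ B) (g : T ⟶ X), ∃ v : T ⟶ V B X, v ≫ p B X = f ∧ v ≫ q B X = g :=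
      fun {T B} f g => ⟨_, (BinaryFan.IsLimit.lift' (hV B X) f g).2⟩
    refine ⟨V A X, p A X, q A X, fun f g => lift f g, fun φ => ⟨?_, ?_⟩⟩
    · obtain ⟨ε, hi, he⟩ := ex φ
      refine ⟨ε, fun {Y} h γ => ⟨fun H T k v hv hφ => ?_, fun H => ?_⟩⟩
      · have h1 := hi v hφ
        rw [hv, forces_comp] at h1
        exact h1.mono H
      · obtain ⟨v, hv, hv'⟩ := lift (p Y X ≫ h) (q Y X)
        refine he h v γ hv hv' ?_
        -- The weak comprehension of `φ(h y, x)` is the generic element to which `H` is applied; its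
        -- fullness turns the forced statement about `γ` into the inequality that ∃-elimination
        -- requires.
        obtain ⟨Z, c, hc, hf⟩ := comprehension _ (pull P v φ)
        refine hf _ (forces_comp.1 (H (c ≫ p Y X) (c ≫ v) ?_ (forces_comp.2 hc.1)))
        rw [Category.assoc, hv, Category.assoc]
    · obtain ⟨υ, he, hi⟩ := all φ
      refine ⟨υ, fun {Y} h => ⟨fun H T k v hv => he v (hv ▸ H.precomp k), fun H => ?_⟩⟩
      obtain ⟨v, hv, hv'⟩ := lift (p Y X ≫ h) (q Y X)
      -- For introduction of the universal quantifier the generic pair `(y, x)` is the only test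
      -- element needed.
      exact hi h v hv hv' (H (p Y X) v hv)

namespace IsFirstOrder

variable {C : Type u} [Category.{v} C] {P : Cᵒᵖ ⥤ SemilatInfCat.{w}} (hP : IsFirstOrder P)

include hP

/-- A full weak comprehension `c` of `α` forces `α`, and by fullness everything that `c` forces lies
above `α`; so testing on `c` alone is already enough. -/
theorem le_iff {A : C} {α β : P.obj (op A)} :
    α ≤ β ↔ ∀ {T : C} (h : T ⟶ A), Forces P h α → Forces P h β := by
  refine ⟨fun le _ h H => H.mono le, fun H => ?_⟩
  obtain ⟨X, c, hc, hf⟩ := hP.comprehension A α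
  exact hf β (H c hc.1)

/-- The predicate is `∃ x, f x = a ∧ β x`. Quantifying over all `h : Y ⟶ A` builds stability under
substitution into the universal property; taking `h` to be the identity yields the left adjoint, and
other `h` yield Beck–Chevalley. -/
theorem exists_along {X A : C} (f : X ⟶ A) (β : P.obj (op X)) :
    ∃ ε : P.obj (op A), ∀ {Y : C} (h : Y ⟶ A) (γ : P.obj (op Y)), pull P h ε ≤ γ ↔
      ∀ {T : C} (k : T ⟶ Y) (l : T ⟶ X), l ≫ f = k ≫ h → Forces P l β → Forces P k γ := by
  obtain ⟨V, p, q, lift, hV⟩ := hP.quantifiers A X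
  obtain ⟨e, he⟩ := hP.eq (q ≫ f) p
  obtain ⟨⟨ε, hε⟩, -⟩ := hV (e ⊓ pull P q β)
  -- An element `l` of `X` over `k ≫ h` corresponds to the pair `(k ≫ h, l)` in `V`; conversely a
  -- pair `v` that forces the equation gives `v ≫ q`. Only existence of pairings is needed.
  refine ⟨ε, fun {Y} h γ => (hε h γ).trans ⟨fun H T k l hl hβ => ?_, fun H T k v hv hφ => ?_⟩⟩
  · obtain ⟨v, h1, h2⟩ := lift (k ≫ h) l
    refine H k v h1 (forces_inf.2 ⟨(he v).2 ?_, ?_⟩)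
    · rw [← Category.assoc, h2, hl, h1]
    · rwa [← forces_comp, h2]
  · rw [forces_inf, he, ← forces_comp] at hφ
    exact H k (v ≫ q) (by rw [Category.assoc, hφ.1, hv]) hφ.2

/-- Dual to `exists_along`, with the predicate `∀ x, f x = a → β x`. -/
theorem forall_along {X A : C} (f : X ⟶ A) (β : P.obj (op X)) :
    ∃ υ : P.obj (op A), ∀ {Y : C} (h : Y ⟶ A), Forces P h υ ↔
      ∀ {T : C} (k : T ⟶ Y) (l : T ⟶ X), l ≫ f = k ≫ h → Forces P l β := by
  obtain ⟨V, p, q, lift, hV⟩ := hP.quantifiers A X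
  obtain ⟨e, he⟩ := hP.eq (q ≫ f) p
  obtain ⟨ι, hι⟩ := hP.imp e (pull P q β)
  obtain ⟨-, υ, hυ⟩ := hV ι
  refine ⟨υ, fun {Y} h => (hυ h).trans ⟨fun H T k l hl => ?_, fun H T k v hv => ?_⟩⟩
  · obtain ⟨v, h1, h2⟩ := lift (k ≫ h) l
    have h3 := (hι v ⊤).1 (H k v h1)
    rw [inf_top_eq, ← pull_comp, h2] at h3
    exact le_trans ((he v).2 (by rw [← Category.assoc, h2, hl, h1])) h3
  · refine (hι v ⊤).2 ?_
    rw [inf_top_eq, hP.le_iff]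
    intro S m hm
    rw [← forces_comp, he] at hm
    rw [← forces_comp, ← forces_comp]
    have := H (m ≫ k) (m ≫ v ≫ q) (by
      simp only [Category.assoc] at hm ⊢
      rw [hm, hv])
    rwa [← Category.assoc] at this

theorem exists_leftAdjoint {X A : C} (f : X ⟶ A) :
    ∃ E : P.obj (op X) → P.obj (op A), GaloisConnection E (pull P f) ∧
      ∀ (α : P.obj (op A)) (β : P.obj (op X)), E (pull P f α ⊓ β) = α ⊓ E β := by
  choose E hE using fun β => hP.exists_along f β
  have gc : GaloisConnection E (pull P f) := fun β γ => by
    have := hE β (𝟙 A) γ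
    rw [pull_id] at this
    rw [this, hP.le_iff]
    refine ⟨fun H T l hl => forces_comp.1 (H (l ≫ f) l (by simp) hl), fun H T k l hl hβ => ?_⟩
    rw [Category.comp_id] at hl
    exact hl ▸ forces_comp.2 (H l hβ)
  refine ⟨E, gc, fun α β => le_antisymm ?_ ?_⟩
  · refine (gc _ _).2 ?_
    rw [pull_inf]
    exact inf_le_inf_left _ (gc.le_u_l β)
  -- The nontrivial half of Frobenius: with `α` moved across the implication the claim reads `E β ≤
  -- ι`, hence `β ≤ P_f(ι)` by adjunction. Since `ι` is an implication also after pulling back along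
  -- `f`, this is the unit of the adjunction.
  · obtain ⟨ι, hι⟩ := hP.imp α (E (pull P f α ⊓ β))
    have h1 := hι (𝟙 A) (E β)
    simp only [pull_id] at h1
    rw [← h1, gc, hι]
    exact gc.le_u_l _

theorem exists_rightAdjoint {X A : C} (f : X ⟶ A) :
    ∃ U : P.obj (op X) → P.obj (op A), GaloisConnection (pull P f) U := by
  choose U hU using fun β => hP.forall_along f β
  refine ⟨U, fun γ β => ?_⟩
  rw [hP.le_iff, hP.le_iff]
  constructor
  · intro H T h hγ
    refine (hU β h).2 fun k l hl => H l ?_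
    rw [← forces_comp, hl]
    exact hγ.precomp k
  · intro H T l hl
    have h1 := (hU β (l ≫ f)).1 (H _ (forces_comp.2 hl)) (𝟙 T) l (by simp)
    exact h1

theorem isElementary [HasFiniteProducts C] : IsElementary P := fun _ _ =>
  hP.exists_leftAdjoint _

/-- One Beck–Chevalley inequality is formal from the adjunctions. The other uses the description of
the left adjoint by elements: the pullback square turns an element of `A'` with a witness in `X`
into an element of `X'`. -/
theorem isExistential : IsExistential P := by
  refine ⟨fun pr _ => hP.exists_leftAdjoint pr, ?_⟩
  intro X' A' X A pr' f' f pr _ sq E E' gE gE' β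
  apply le_antisymm
  · refine (gE' _ _).2 ?_
    rw [← pull_comp, sq.w, pull_comp]
    exact pull_mono P f' (gE.le_u_l β)
  -- The given `E` is an arbitrary left adjoint, about whose pullbacks nothing is known directly; it
  -- is bounded by `ε`, whose universal property persists along `f`.
  · obtain ⟨ε, hε⟩ := hP.exists_along pr β
    have h1 : E β ≤ ε := (gE _ _).2 (hP.le_iff.2 fun l hl => by
      have h2 := (hε (𝟙 A) ε).1 (pull_id P ε).le (l ≫ pr) l (by simp) hl
      exact forces_comp.1 h2)
    refine (pull_mono P f h1).trans ((hε f _).2 fun {T} k l hl hβ => ?_)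
    obtain ⟨m, hm, hm'⟩ : ∃ m : T ⟶ X', m ≫ pr' = k ∧ m ≫ f' = l :=
      ⟨sq.lift k l hl.symm, sq.lift_fst _ _ _, sq.lift_snd _ _ _⟩
    rw [← hm, forces_comp]
    refine Forces.mono ?_ (gE'.le_u_l _)
    rwa [← forces_comp, hm']

theorem isImplicational : IsImplicational P := fun A α => by
  choose I hI using fun β => hP.imp α β
  refine ⟨I, fun γ β => ?_⟩
  have := hI β (𝟙 A) γ
  simp only [pull_id] at this
  exact this.symm

/-- As in the existential case, one inequality is formal, and the other compares the arbitrary right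
adjoint `U` with the predicate of `forall_along`, whose forcing condition after substitution along
`f` is checked on elements of `X'`. -/
theorem isUniversal : IsUniversal P := by
  refine ⟨fun pr _ => hP.exists_rightAdjoint pr, ?_⟩
  intro X' A' X A pr' f' f pr _ sq U U' gU gU' β
  apply le_antisymm
  · refine (gU' _ _).1 ?_
    rw [← pull_comp, sq.w, pull_comp]
    exact pull_mono P f' (gU.l_u_le β)
  · obtain ⟨υ, hυ⟩ := hP.forall_along pr β
    have h1 : υ ≤ U β := (gU _ _).1 (hP.le_iff.2 fun {T} l hl =>
      (hυ (l ≫ pr)).1 (forces_comp.2 hl) (𝟙 T) l (by simp))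
    refine le_trans (hP.le_iff.2 fun {Y} h hh => ?_) (pull_mono P f h1)
    rw [← forces_comp, hυ]
    intro T k l hl
    obtain ⟨m, hm, hm'⟩ : ∃ m : T ⟶ X', m ≫ pr' = k ≫ h ∧ m ≫ f' = l :=
      ⟨sq.lift (k ≫ h) l (by rw [hl, Category.assoc]), sq.lift_fst _ _ _, sq.lift_snd _ _ _⟩
    have h2 := hh.precomp k
    rw [← hm, forces_comp] at h2
    rw [← hm', forces_comp]
    exact h2.mono (gU'.l_u_le _)

/-- An element `g` of `A ⨯ A` forces `E ⊤` exactly when it factors through the diagonal: `E ⊤` lies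
below the equality predicate of the two projections, and forcing that predicate makes the components
of `g` equal. Stability then uses any weak comprehension of the substituted predicate. -/
theorem hasComprehensiveWeakEqualizers [HasFiniteProducts C] :
    HasComprehensiveWeakEqualizers P := fun A => by
  obtain ⟨E, gE, -⟩ := hP.exists_leftAdjoint (diag A)
  have key : ∀ {T : C} (g : T ⟶ A ⨯ A), Forces P g (E ⊤) ↔ ∃ h : T ⟶ A, h ≫ diag A = g := by
    intro T g
    constructor
    · intro hg
      obtain ⟨e, he⟩ := hP.eq (prod.fst : A ⨯ A ⟶ A) prod.snd
      have h1 : E ⊤ ≤ e := (gE _ _).2 ((he (diag A)).2 (by rw [prod.lift_fst, prod.lift_snd]))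
      have h2 := (he g).1 (hg.mono h1)
      exact ⟨g ≫ prod.fst, Limits.prod.hom_ext
        (by rw [Category.assoc, prod.lift_fst, Category.comp_id])
        (by rw [Category.assoc, prod.lift_snd, Category.comp_id, h2])⟩
    · rintro ⟨h, rfl⟩
      exact forces_comp.2 (forces_top.mono (gE.le_u_l ⊤))
  refine ⟨E, gE, ⟨gE.le_u_l ⊤, fun g hg => (key g).1 hg⟩, fun {A'} f => ?_⟩
  obtain ⟨X', c, hc, -⟩ := hP.comprehension A' (pull P f (E ⊤))
  obtain ⟨f', hf'⟩ := (key (c ≫ f)).1 (forces_comp.2 hc.1)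
  refine ⟨X', c, f', hc, hf'.symm, fun {T} s t hst => ?_⟩
  obtain ⟨m, hm⟩ := hc.2 s (forces_comp.1 ((key (s ≫ f)).2 ⟨t, hst.symm⟩))
  refine ⟨m, hm, ?_⟩
  -- The diagonal is monic, so the second triangle of the weak pullback follows from the first.
  rw [← cancel_mono (diag A), Category.assoc, hf', ← Category.assoc, hm, hst]

end IsFirstOrder

/-! ### Independence of weak exponentials from the choice of products. -/

/-- Weak exponentials with respect to any choice of binary products. -/
theorem weaklyCartesianClosed_of_isLimit {C : Type u} [Category.{v} C] [HasFiniteProducts C]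
    (V : C → C → C) (p : ∀ A B, V A B ⟶ A) (q : ∀ A B, V A B ⟶ B)
    (hV : ∀ A B, IsLimit (BinaryFan.mk (p A B) (q A B)))
    (hexp : ∀ A B : C, ∃ (W : C) (ev : V W A ⟶ B), ∀ {X : C} (f : V X A ⟶ B),
      ∃ f' : X ⟶ W, ∀ v : V X A ⟶ V W A, v ≫ p W A = p X A ≫ f' → v ≫ q W A = q X A →
        f = v ≫ ev) : WeaklyCartesianClosed C := fun A B => by
  obtain ⟨W, ev, hW⟩ := hexp A B
  have e : ∀ X, ∃ i : V X A ≅ X ⨯ A, i.hom ≫ prod.fst = p X A ∧ i.hom ≫ prod.snd = q X A :=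
    fun X => ⟨(hV X A).conePointUniqueUpToIso (limit.isLimit _),
      (hV X A).conePointUniqueUpToIso_hom_comp (limit.isLimit _) (.mk .left),
      (hV X A).conePointUniqueUpToIso_hom_comp (limit.isLimit _) (.mk .right)⟩
  obtain ⟨j, hj, hj'⟩ := e W
  have hjp : j.inv ≫ p W A = prod.fst := by rw [← hj, j.inv_hom_id_assoc]
  have hjq : j.inv ≫ q W A = prod.snd := by rw [← hj', j.inv_hom_id_assoc]
  refine ⟨W, j.inv ≫ ev, fun {X} f => ?_⟩
  obtain ⟨i, hi, hi'⟩ := e X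
  obtain ⟨f', hf'⟩ := hW (i.hom ≫ f)
  refine ⟨f', ?_⟩
  -- The arrow `f' × id`, transported to the given products on both sides, is the `v` for which the
  -- evaluation equation is assumed.
  have := hf' (i.hom ≫ prod.map f' (𝟙 A) ≫ j.inv) (by simp [hjp, ← hi]) (by simp [hjq, ← hi'])
  rw [← cancel_epi i.hom, this]
  simp

end Doctrine

/-! ### Strong sums in type theory: projections, β-rules and propositional η. -/

namespace MTT

namespace Expr

theorem subst_congr {n m : ℕ} {σ τ : Fin n → Expr m} (h : ∀ i, σ i = τ i) (e : Expr n) :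
    e.subst σ = e.subst τ := by rw [funext h]

theorem wk_eq_subst {n : ℕ} (e : Expr n) : e.wk = e.subst (fun i => var i.succ) :=
  ren_eq_subst _ _

/-- First projection of an element of an indexed sum. -/
def fst {n : ℕ} (d : Expr n) : Expr n := .elSigma d (.var 1)

/-- Second projection of an element of an indexed sum. -/
def snd {n : ℕ} (d : Expr n) : Expr n := .elSigma d (.var 0)

end Expr

namespace Derivable

open MTT.Expr

/-- A well-typed substitution extended by a term of type `B`. -/
theorem scons_var {n m : ℕ} {Γ : Ctx n} {Δ : Ctx m} {B : Expr n} {a : Expr m}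
    {σ : Fin n → Expr m} (hσ : ∀ i, Derivable Δ (.tm (σ i) ((Γ.get i).subst σ)))
    (ha : Derivable Δ (.tm a (B.subst σ))) (i : Fin (n + 1)) :
    Derivable Δ (.tm (scons a σ i) (((Γ.snoc B).get i).subst (scons a σ))) := by
  refine Fin.cases ?_ (fun i => ?_) i
  · exact ha.tm_cast rfl (Expr.subst_wk (scons a σ) B).symm
  · exact (hσ i).tm_cast rfl (Expr.subst_wk (scons a σ) _).symm

theorem scons_tmEq {n m : ℕ} {Γ : Ctx n} {Δ : Ctx m} {B : Expr n} {a b : Expr m}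
    {σ τ : Fin n → Expr m} (hσ : ∀ i, Derivable Δ (.tmEq (σ i) (τ i) ((Γ.get i).subst σ)))
    (hab : Derivable Δ (.tmEq a b (B.subst σ))) (i : Fin (n + 1)) :
    Derivable Δ (.tmEq (scons a σ i) (scons b τ i) (((Γ.snoc B).get i).subst (scons a σ))) := by
  refine Fin.cases ?_ (fun i => ?_) i
  · exact hab.cast (congrArg (Judgment.tmEq a b) (Expr.subst_wk (scons a σ) B).symm)
  · exact (hσ i).cast (congrArg (Judgment.tmEq _ _) (Expr.subst_wk (scons a σ) _).symm)

theorem var_succ {n : ℕ} {Γ : Ctx n} {A : Expr n} (hA : Derivable Γ (.type .col A)) (i : Fin n) :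
    Derivable (Γ.snoc A) (.tm (.var i.succ) ((Γ.get i).subst (fun i => .var i.succ))) :=
  (Derivable.var (Γ := Γ.snoc A) i.succ (.ctx_snoc hA)).tm_cast rfl (wk_eq_subst _)

theorem var_zero {n : ℕ} {Γ : Ctx n} {A : Expr n} (hA : Derivable Γ (.type .col A)) :
    Derivable (Γ.snoc A) (.tm (.var 0) A.wk) :=
  Derivable.var (Γ := Γ.snoc A) 0 (.ctx_snoc hA)

/-- Substituting the definitionally equal terms `a` and `b` for `y` in `Id(A, a, y)` gives
definitionally equal types, so the reflexivity proof can be converted. -/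
theorem id_of_tmEq {n : ℕ} {Γ : Ctx n} {A a b : Expr n} (hΓ : Derivable Γ .ctx)
    (hA : Derivable Γ (.type .col A)) (ha : Derivable Γ (.tm a A))
    (h : Derivable Γ (.tmEq a b A)) : Derivable Γ (.tm (.idRefl A a) (.id A a b)) := by
  have h1 : Derivable (Γ.snoc A) (.type .prop (.id A.wk a.wk (.var 0))) :=
    .id_prop (hA.weaken_type hA) (ha.weaken_tm hA) (var_zero hA)
  have h2 := type_congr (Δ := Γ) (scons a Expr.var) (scons b Expr.var) h1 hΓ
    (scons_tmEq (fun i => .tm_refl ((Derivable.var i hΓ).tm_cast rfl (subst_var _).symm))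
      (h.cast (by rw [subst_var])))
  refine .conv (.idRefl hA ha) (.prop_col_eq (h2.cast ?_))
  simp only [Expr.subst, Judgment.typeEq.injEq, true_and]
  exact ⟨by rw [Expr.subst_wk, Expr.subst_wk]; exact congrArg₂ (Expr.id · · a) (subst_var _) (subst_var _),
    by rw [Expr.subst_wk, Expr.subst_wk]; exact congrArg₂ (Expr.id · · b) (subst_var _) (subst_var _)⟩

/-- Weakening below the last declaration. -/
theorem weaken_up {n : ℕ} {Γ : Ctx n} {A B : Expr n} {C : Expr (n + 1)} {K : Kind}
    (hC : Derivable (Γ.snoc B) (.type K C)) (hA : Derivable Γ (.type .col A))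
    (hB : Derivable Γ (.type .col B)) :
    Derivable ((Γ.snoc A).snoc B.wk) (.type K (C.ren (upr Fin.succ))) := by
  have h := hC.subst_up (Δ := Γ.snoc A) (var_succ hA) ((hB.weaken_type hA).cast (by
    rw [wk_eq_subst]))
  rw [← wk_eq_subst] at h
  refine h.cast (congrArg (Judgment.type K) ?_)
  rw [ren_eq_subst]
  exact subst_congr (fun i => Fin.cases rfl (fun i => rfl) i) C

theorem snd_motive_inst {n : ℕ} (C : Expr (n + 1)) (d : Expr n) :
    (C.subst (scons (Expr.fst (.var 0)) (fun i => .var i.succ))).inst d = C.inst (Expr.fst d) := by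
  rw [Expr.inst, subst_subst]
  exact subst_congr (fun i => Fin.cases rfl (fun i => rfl) i) C

theorem inst_congr {n : ℕ} {Γ : Ctx n} {B : Expr n} {K : Kind} {D : Expr (n + 1)} {a b : Expr n} (hΓ : Derivable Γ .ctx)
    (hD : Derivable (Γ.snoc B) (.type K D)) (hab : Derivable Γ (.tmEq a b B)) :
    Derivable Γ (.typeEq K (D.inst a) (D.inst b)) :=
  type_congr _ _ hD hΓ (scons_tmEq
    (fun i => .tm_refl ((Derivable.var i hΓ).tm_cast rfl (subst_var _).symm))
    (hab.cast (by rw [subst_var])))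

section Sigma

variable {n : ℕ} {Γ : Ctx n} {B : Expr n} {C : Expr (n + 1)}
  (hB : Derivable Γ (.type .col B)) (hC : Derivable (Γ.snoc B) (.type .col C))
include hB hC

theorem fst_motive : Derivable ((Γ.snoc B).snoc C)
    (.tm (.var 1) (B.wk.instAt 2 (.pair (.var 1) (.var 0)))) := by
  refine ((var_zero hB).weaken_tm hC).tm_cast rfl ?_
  rw [instAt, Expr.subst_wk, Expr.wk, Expr.wk, ren_ren, ren_eq_subst]
  rfl

theorem fst {d : Expr n} (hd : Derivable Γ (.tm d (.sigma B C))) :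
    Derivable Γ (.tm (Expr.fst d) B) :=
  (Derivable.elSigma (hB.weaken_type (.sigma_col hB hC)) hd (fst_motive hB hC)).tm_cast rfl
    (wk_inst _ _)

theorem fst_pair {b c : Expr n} (hb : Derivable Γ (.tm b B)) (hc : Derivable Γ (.tm c (C.inst b))) :
    Derivable Γ (.tmEq (Expr.fst (.pair b c)) b B) :=
  (Derivable.elSigma_pair (hB.weaken_type (.sigma_col hB hC)) hb hc (fst_motive hB hC)).cast
    (by rw [wk_inst]; rfl)

/-- The type of the second projection depends on the first: the motive is `C(fst z)`. -/
theorem snd_motive : Derivable (Γ.snoc (.sigma B C))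
    (.type .col (C.subst (scons (Expr.fst (.var 0)) (fun i => .var i.succ)))) := by
  have hS := Derivable.sigma_col hB hC
  refine subst _ hC (.ctx_snoc hS) (scons_var (var_succ hS) ?_)
  exact (fst (hB.weaken_type hS) (hC.weaken_up hS hB) (var_zero hS)).tm_cast rfl (wk_eq_subst _)

theorem pair_vars : Derivable ((Γ.snoc B).snoc C)
    (.tm (.pair (.var 1) (.var 0)) (Expr.sigma B C).wk.wk) := by
  have h1 := (var_zero hB).weaken_tm hC
  refine .pair (B := B.wk.wk) ((hC.weaken_up hB hB).weaken_up hC (hB.weaken_type hB)) h1 ((var_zero hC).tm_cast rfl ?_)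
  rw [ren_ren, Expr.inst, subst_ren, wk_eq_subst]
  exact subst_congr (fun i => Fin.cases rfl (fun i => rfl) i) C

theorem fst_pair_vars : Derivable ((Γ.snoc B).snoc C)
    (.tmEq (Expr.fst (.pair (.var 1) (.var 0))) (.var 1) B.wk.wk) := by
  refine fst_pair (B := B.wk.wk) (C := (C.ren (upr Fin.succ)).ren (upr Fin.succ))
    ((hB.weaken_type hB).weaken_type hC) ((hC.weaken_up hB hB).weaken_up hC (hB.weaken_type hB))
    ((var_zero hB).weaken_tm hC) ((var_zero hC).tm_cast rfl ?_)
  rw [ren_ren, Expr.inst, subst_ren, wk_eq_subst]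
  exact subst_congr (fun i => Fin.cases rfl (fun i => rfl) i) C

/-- The variable `y` has type `C(x)`, whereas the eliminator that defines the second projection asks
for a term of `C(fst ⟨x, y⟩)`. The β-rule for the first projection makes the two types
definitionally equal. -/
theorem snd_type_pair_vars : Derivable ((Γ.snoc B).snoc C)
    (.typeEq .col C.wk
      ((C.subst (scons (Expr.fst (.var 0)) (fun i => .var i.succ))).instAt 2
        (.pair (.var 1) (.var 0)))) := by
  have hc : Derivable ((Γ.snoc B).snoc C) .ctx := .ctx_snoc hC
  have := type_congr (scons (.var 1) (fun i => .var i.succ.succ))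
    (scons (Expr.fst (.pair (.var 1) (.var 0))) (fun i => .var i.succ.succ)) hC hc
    (scons_tmEq (fun i => .tm_refl ?_) ?_)
  · refine this.cast ?_
    rw [wk_eq_subst, instAt, subst_subst]
    exact congrArg₂ (Judgment.typeEq _) (subst_congr (fun i => Fin.cases rfl (fun i => rfl) i) C)
      (subst_congr (fun i => Fin.cases rfl (fun i => rfl) i) C)
  · refine (Derivable.var (Γ := (Γ.snoc B).snoc C) i.succ.succ hc).tm_cast rfl ?_
    simp only [Ctx.get, Fin.cases_succ, wk_eq_subst, subst_subst, Expr.subst]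
  · refine (fst_pair_vars hB hC).tm_symm.cast ?_
    simp only [wk_eq_subst, subst_subst, Expr.subst]

theorem snd_var : Derivable ((Γ.snoc B).snoc C)
    (.tm (.var 0) ((C.subst (scons (Expr.fst (.var 0)) (fun i => .var i.succ))).instAt 2
        (.pair (.var 1) (.var 0)))) :=
  .conv (var_zero hC) (snd_type_pair_vars hB hC)

theorem snd {d : Expr n} (hd : Derivable Γ (.tm d (.sigma B C))) :
    Derivable Γ (.tm (Expr.snd d) (C.inst (Expr.fst d))) :=
  (Derivable.elSigma (snd_motive hB hC) hd (snd_var hB hC)).tm_cast rfl (snd_motive_inst C d)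

theorem snd_pair {b c : Expr n} (hΓ : Derivable Γ .ctx) (hb : Derivable Γ (.tm b B))
    (hc : Derivable Γ (.tm c (C.inst b))) :
    Derivable Γ (.tmEq (Expr.snd (.pair b c)) c (C.inst b)) := by
  have h := Derivable.elSigma_pair (snd_motive hB hC) hb hc (snd_var hB hC)
  rw [snd_motive_inst] at h
  exact .conv_eq h (inst_congr hΓ hC (fst_pair hB hC hb hc))

theorem snd_pair_vars : Derivable ((Γ.snoc B).snoc C)
    (.tmEq (Expr.snd (.pair (.var 1) (.var 0))) (.var 0) C.wk) := by
  have e : C.wk = ((C.ren (upr Fin.succ)).ren (upr Fin.succ)).inst (Expr.var 1) := by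
    rw [ren_ren, Expr.inst, subst_ren, wk_eq_subst]
    exact subst_congr (fun i => Fin.cases rfl (fun i => rfl) i) C
  rw [e]
  exact snd_pair (B := B.wk.wk) (C := (C.ren (upr Fin.succ)).ren (upr Fin.succ))
    ((hB.weaken_type hB).weaken_type hC) ((hC.weaken_up hB hB).weaken_up hC (hB.weaken_type hB)) (.ctx_snoc hC)
    ((var_zero hB).weaken_tm hC) ((var_zero hC).tm_cast rfl e)

/-- Judgements in `Γ, x ∈ B, y ∈ C` are unaffected by the substitution of the projections of
`⟨x, y⟩`. -/
theorem proj_pair_vars (i : Fin (n + 2)) : Derivable ((Γ.snoc B).snoc C)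
    (.tmEq (scons (Expr.snd (.pair (.var 1) (.var 0)))
        (scons (Expr.fst (.pair (.var 1) (.var 0))) (fun i => .var i.succ.succ)) i) (.var i)
      ((((Γ.snoc B).snoc C).get i).subst (scons (Expr.snd (.pair (.var 1) (.var 0)))
        (scons (Expr.fst (.pair (.var 1) (.var 0))) (fun i => .var i.succ.succ))))) := by
  have hc : Derivable ((Γ.snoc B).snoc C) .ctx := .ctx_snoc hC
  -- The right-hand side is first written as the tuple `(…, x, y)`, so that the equality can be
  -- proved one component at a time; this tuple is the identity substitution.
  have h : ∀ i, Derivable ((Γ.snoc B).snoc C)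
    (.tmEq (scons (Expr.snd (.pair (.var 1) (.var 0)))
        (scons (Expr.fst (.pair (.var 1) (.var 0))) (fun i => .var i.succ.succ)) i)
      (scons (.var 0) (scons (.var 1) (fun i => .var i.succ.succ)) i)
      ((((Γ.snoc B).snoc C).get i).subst (scons (Expr.snd (.pair (.var 1) (.var 0)))
        (scons (Expr.fst (.pair (.var 1) (.var 0))) (fun i => .var i.succ.succ))))) := by
    refine scons_tmEq (scons_tmEq (fun i => .tm_refl ?_) ?_) ?_
    · refine (Derivable.var (Γ := (Γ.snoc B).snoc C) i.succ.succ hc).tm_cast rfl ?_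
      simp only [Ctx.get, Fin.cases_succ, wk_eq_subst, subst_subst, Expr.subst]
    · refine (fst_pair_vars hB hC).cast ?_
      simp only [wk_eq_subst, subst_subst, Expr.subst]
    -- The last component is compared at the type `C(fst ⟨x, y⟩)`, not at `C(x)`.
    · refine .conv_eq (snd_pair_vars hB hC) ((snd_type_pair_vars hB hC).cast ?_)
      rw [instAt, subst_subst]
      exact congrArg (Judgment.typeEq _ _)
        (subst_congr (fun i => Fin.cases rfl (fun i => rfl) i) C)
  exact (h i).cast (congrArg (Judgment.tmEq _ · _)
    (Fin.cases rfl (fun i => Fin.cases rfl (fun i => rfl) i) i))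

/-- Propositions are collections, so the Σ-eliminator may have the identity proposition as its
motive. This reduces the claim to `d = ⟨x, y⟩`, where the β-rules give even a definitional equality.
-/
theorem sigma_eta {d : Expr n} (hd : Derivable Γ (.tm d (.sigma B C))) :
    ∃ p, Derivable Γ (.tm p (.id (.sigma B C) d (.pair (Expr.fst d) (Expr.snd d)))) := by
  have hS := Derivable.sigma_col hB hC
  have hB' := hB.weaken_type hS
  have hC' := hC.weaken_up hS hB
  have hM : Derivable (Γ.snoc (.sigma B C)) (.type .prop (.id (Expr.sigma B C).wk (.var 0)
      (.pair (Expr.fst (.var 0)) (Expr.snd (.var 0))))) :=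
    .id_prop (hS.weaken_type hS) (var_zero hS) (.pair hC' (fst hB' hC' (var_zero hS))
      (snd hB' hC' (var_zero hS)))
  have hc : Derivable ((Γ.snoc B).snoc C) .ctx := .ctx_snoc hC
  -- There is no separate congruence rule for pairing: it comes from substituting equal terms for
  -- the variables of the term `⟨x, y⟩`.
  have h1 := id_of_tmEq hc ((hS.weaken_type hB).weaken_type hC) (pair_vars hB hC)
    (b := .pair (Expr.fst (.pair (.var 1) (.var 0))) (Expr.snd (.pair (.var 1) (.var 0))))
    (.tm_symm ((tm_congr _ _ (pair_vars hB hC) hc (proj_pair_vars hB hC)).cast (by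
      refine congrArg (Judgment.tmEq _ _) ?_
      simp only [wk_eq_subst, subst_subst]
      rfl)))
  refine ⟨_, (Derivable.elSigma (.prop_col hM) hd (h1.tm_cast rfl ?_)).tm_cast rfl ?_⟩
  · simp only [instAt, Expr.subst, Expr.subst_wk]
    refine congrArg (Expr.id · _ _) ?_
    simp only [wk_eq_subst, subst_subst]
    rfl
  · simp only [Expr.inst, Expr.subst, Expr.subst_wk]
    exact congrArg (Expr.id · _ _) (subst_var (Expr.sigma B C))

end Sigma

end Derivable
end MTT

/-! ### Finite products of closed collections and of closed sets. -/

namespace MTT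

open MTT.Expr

namespace Derivable

/-- Weakening of a term below the last declaration. -/
theorem weaken_up_tm {n : ℕ} {Γ : Ctx n} {A B : Expr n} {c C : Expr (n + 1)}
    (hc : Derivable (Γ.snoc B) (.tm c C)) (hA : Derivable Γ (.type .col A))
    (hB : Derivable Γ (.type .col B)) :
    Derivable ((Γ.snoc A).snoc B.wk) (.tm (c.ren (upr Fin.succ)) (C.ren (upr Fin.succ))) := by
  have h := hc.subst_up (Δ := Γ.snoc A) (var_succ hA) ((hB.weaken_type hA).cast (by
    rw [wk_eq_subst]))
  rw [← wk_eq_subst] at h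
  have e : ∀ e : Expr (n + 1), e.subst (up (fun i => .var i.succ)) = e.ren (upr Fin.succ) :=
    fun e => (subst_congr (fun i => Fin.cases rfl (fun i => rfl) i) e).trans (ren_eq_subst _ _).symm
  exact h.tm_cast (e c) (e C)

/-- A proposition in the context `Γ, x ∈ B, y ∈ C` that holds for the projections of every element
of `Σ B C` holds. -/
theorem of_proj {n : ℕ} {Γ : Ctx n} {B : Expr n} {C : Expr (n + 1)} {χ : Expr (n + 2)}
    {p : Expr (n + 1)} (hB : Derivable Γ (.type .col B)) (hC : Derivable (Γ.snoc B) (.type .col C))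
    (hχ : Derivable ((Γ.snoc B).snoc C) (.type .prop χ))
    (hp : Derivable (Γ.snoc (.sigma B C)) (.tm p (χ.subst (scons (Expr.snd (.var 0))
      (scons (Expr.fst (.var 0)) (fun i => .var i.succ)))))) :
    ∃ q, Derivable ((Γ.snoc B).snoc C) (.tm q χ) := by
  have hc : Derivable ((Γ.snoc B).snoc C) .ctx := .ctx_snoc hC
  -- Substituting `⟨x, y⟩` for the element of the sum yields `χ(fst ⟨x, y⟩, snd ⟨x, y⟩)`, which
  -- `proj_pair_vars` converts to `χ(x, y)`; no η is involved.
  have h1 := subst (scons (.pair (.var 1) (.var 0)) (fun i => .var i.succ.succ)) hp hc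
    (scons_var (fun i => ?_) ?_)
  · refine ⟨_, .conv (h1.tm_cast rfl ?_) (.prop_col_eq ((type_congr _ _ hχ hc
      (proj_pair_vars hB hC)).cast (by rw [subst_var])))⟩
    rw [subst_subst]
    exact subst_congr (fun i => Fin.cases rfl (fun i => Fin.cases rfl (fun i => rfl) i) i) χ
  · refine (Derivable.var (Γ := (Γ.snoc B).snoc C) i.succ.succ hc).tm_cast rfl ?_
    simp only [Ctx.get, Fin.cases_succ, wk_eq_subst, subst_subst, Expr.subst]
  · refine (pair_vars hB hC).tm_cast rfl ?_
    rw [wk_eq_subst, wk_eq_subst, subst_subst]; rfl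

/-- Terms preserve propositional equality. -/
theorem id_congr {n : ℕ} {Γ : Ctx n} {A D a b p : Expr n} {e : Expr (n + 1)}
    (hΓ : Derivable Γ .ctx) (hA : Derivable Γ (.type .col A)) (hD : Derivable Γ (.type .col D))
    (ha : Derivable Γ (.tm a A)) (hb : Derivable Γ (.tm b A))
    (hp : Derivable Γ (.tm p (.id A a b))) (he : Derivable (Γ.snoc A) (.tm e D.wk)) :
    ∃ r, Derivable Γ (.tm r (.id D (e.inst a) (e.inst b))) := by
  have hea : Derivable Γ (.tm (e.inst a) D) := (he.inst hΓ ha).tm_cast rfl (wk_inst D a)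
  -- Transport along `p` of the reflexivity proof in the predicate `Id(D, e(a), e(y))`.
  obtain ⟨r, hr⟩ := leibniz (φ := .id D.wk (e.inst a).wk e) hA ha hb hp
    (.id_prop (hD.weaken_type hA) (hea.weaken_tm hA) he)
    ((Derivable.idRefl hD hea).tm_cast rfl
      (congrArg₂ (Expr.id · · (e.inst a)) (wk_inst D a).symm (wk_inst _ a).symm))
  exact ⟨r, hr.tm_cast rfl (congrArg₂ (Expr.id · · (e.inst b)) (wk_inst D b) (wk_inst _ b))⟩

theorem ex_le {n : ℕ} {Γ : Ctx n} {B A : Expr n} {C q : Expr (n + 1)}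
    (hB : Derivable Γ (.type .col B)) (hC : Derivable (Γ.snoc B) (.type .prop C))
    (hA : Derivable Γ (.type .prop A)) (hq : Derivable (Γ.snoc B) (.tm q (.imp C A.wk))) :
    ∃ r, Derivable (Γ.snoc (.ex B C)) (.tm r A.wk) := by
  have hE : Derivable Γ (.type .col (.ex B C)) := .prop_col (.ex_prop hB hC)
  have hC' := prop_col (hC.weaken_up hE hB)
  refine ⟨_, .elEx (hA.weaken_type hE) (var_zero hE)
    (.impApp (((hq.weaken_up_tm hE hB).weaken_tm hC').tm_cast rfl ?_) (var_zero hC'))⟩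
  refine congrArg (Expr.imp _) ?_
  simp only [Expr.wk, ren_ren]; rfl

end Derivable

namespace CM

/-- The closed collection `Σ A C`. -/
def sigma (A : CM) (C : Expr 1) (hC : Derivable A.ctx (.type .col C)) : CM :=
  ⟨.sigma A.carrier C, .sigma_col A.isCol hC⟩

section Sigma

variable {T A : CM} {C : Expr 1} {hC : Derivable A.ctx (.type .col C)}

theorem inst_ren_upr (C : Expr 1) (b : Expr 1) :
    (C.ren (upr Fin.succ)).inst b = C.subst (fun _ => b) := by
  rw [Expr.inst, subst_ren]
  exact subst_congr (fun i => Fin.cases rfl (fun i => i.elim0) i) C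

/-- First projection of a term of `Σ A C`. -/
def Term.fst (d : Term T (sigma A C hC)) : Term T A :=
  ⟨Expr.fst d.1, Derivable.fst (T.col_wk A) (hC.weaken_up T.isCol A.isCol) d.2⟩

theorem Term.snd_der (d : Term T (sigma A C hC)) :
    Derivable T.ctx (.tm (Expr.snd d.1) (C.subst (fun _ => Expr.fst d.1))) :=
  (Derivable.snd (T.col_wk A) (hC.weaken_up T.isCol A.isCol) d.2).tm_cast rfl (inst_ren_upr C _)

/-- The term `⟨t, c⟩` of `Σ A C`. -/
def Term.pair (hC : Derivable A.ctx (.type .col C)) (t : Term T A) (c : Expr 1)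
    (hc : Derivable T.ctx (.tm c (C.subst (fun _ => t.1)))) : Term T (sigma A C hC) :=
  ⟨.pair t.1 c, .pair (hC.weaken_up T.isCol A.isCol) t.2 (hc.tm_cast rfl (inst_ren_upr C _).symm)⟩

theorem homMk_eq_iff {A B : CM} (t s : Term A B) :
    homMk t = homMk s ↔ ∃ p, Derivable A.ctx (.tm p (.id B.carrier.wk t.1 s.1)) :=
  Quotient.eq (r := Term.setoid A B)

theorem homMk_surjective {A B : CM} (f : A ⟶ B) : ∃ t, homMk t = f :=
  Quotient.exists_rep f

theorem homMk_eq {A B : CM} {t s : Term A B}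
    (h : Derivable A.ctx (.tmEq t.1 s.1 B.carrier.wk)) : homMk t = homMk s :=
  (homMk_eq_iff t s).2 ⟨_, Derivable.id_of_tmEq A.ctx_ok (A.col_wk B) t.2 h⟩

theorem fst_pair (t : Term T A) {c : Expr 1}
    (hc : Derivable T.ctx (.tm c (C.subst (fun _ => t.1)))) :
    homMk (Term.pair hC t c hc).fst = homMk t :=
  homMk_eq (Derivable.fst_pair (T.col_wk A) (hC.weaken_up T.isCol A.isCol) t.2
    (hc.tm_cast rfl (inst_ren_upr C _).symm))

theorem pair_eta (d : Term T (sigma A C hC)) :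
    homMk (Term.pair hC d.fst _ d.snd_der) = homMk d :=
  ((homMk_eq_iff _ _).2
    (Derivable.sigma_eta (T.col_wk A) (hC.weaken_up T.isCol A.isCol) d.2)).symm

/-- The projection `Σ A C → A`. -/
def proj (hC : Derivable A.ctx (.type .col C)) : sigma A C hC ⟶ A := homMk (Term.ident _).fst

end Sigma

theorem homMk_comp {A B D : CM} (t : Term A B) (s : Term B D) :
    homMk t ≫ homMk s = homMk (t.comp s) := rfl

/-- The product `A × B` of closed collections. -/
abbrev prod (A B : CM) : CM := sigma A B.carrier.wk (A.col_wk B)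

section Prod

variable {T A B : CM}

/-- Second projection of a term of `A × B`. -/
def Term.snd (d : Term T (prod A B)) : Term T B :=
  ⟨Expr.snd d.1, d.snd_der.tm_cast rfl (wk_subst_one _ _)⟩

/-- The term `⟨t, s⟩` of `A × B`. -/
def Term.lift (t : Term T A) (s : Term T B) : Term T (prod A B) :=
  Term.pair (A.col_wk B) t s.1 (s.2.tm_cast rfl (wk_subst_one _ _).symm)

/-- The first projection of `A × B`. -/
abbrev pr₁ (A B : CM) : prod A B ⟶ A := proj (A.col_wk B)

/-- The second projection of `A × B`. -/
def pr₂ (A B : CM) : prod A B ⟶ B := homMk (Term.ident _).snd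

theorem lift_pr₁ (t : Term T A) (s : Term T B) : homMk (t.lift s) ≫ pr₁ A B = homMk t :=
  fst_pair t _

theorem lift_pr₂ (t : Term T A) (s : Term T B) : homMk (t.lift s) ≫ pr₂ A B = homMk s := by
  refine homMk_eq (s := s) ?_
  have hs := s.2.tm_cast rfl (wk_subst_one B.carrier (fun _ => t.1)).symm
  refine (Derivable.snd_pair (T.col_wk A) ((A.col_wk B).weaken_up T.isCol A.isCol) T.ctx_ok t.2
    (hs.tm_cast rfl (inst_ren_upr _ _).symm)).cast ?_
  exact congrArg (Judgment.tmEq _ _) ((inst_ren_upr _ _).trans (wk_subst_one _ _))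

/-- The components are replaced one at a time, through `⟨t', s⟩`. This is possible without transport
because the type of the second component is closed and so does not vary with the first. -/
theorem lift_congr {t t' : Term T A} {s s' : Term T B} (h : homMk t = homMk t')
    (h' : homMk s = homMk s') : homMk (t.lift s) = homMk (t'.lift s') := by
  rw [homMk_eq_iff] at h h'
  obtain ⟨p, hp⟩ := h
  obtain ⟨p', hp'⟩ := h'
  have hA := T.col_wk A
  have hB := T.col_wk B
  have hC := (A.col_wk B).weaken_up T.isCol A.isCol
  have e : ∀ (u : Expr 2), ((B.carrier.wk.ren (upr Fin.succ)).ren (upr Fin.succ)).inst u =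
      (B.carrier.wk.wk : Expr 2) := fun u => by
    simp only [Expr.inst, wk_eq_subst, ren_eq_subst, subst_subst]
    exact closed_subst _ _ _
  have h1 := Derivable.id_congr (e := .pair (.var 0) s.1.wk) T.ctx_ok hA (T.col_wk (prod A B)) t.2
    t'.2 hp (.pair (hC.weaken_up hA hA) (Derivable.var_zero hA)
      ((s.2.weaken_tm hA).tm_cast rfl (e _).symm))
  have h2 := Derivable.id_congr (e := .pair t'.1.wk (.var 0)) T.ctx_ok hB (T.col_wk (prod A B)) s.2
    s'.2 hp' (.pair (hC.weaken_up hB hA) (t'.2.weaken_tm hB)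
      ((Derivable.var_zero hB).tm_cast rfl (e _).symm))
  refine ((homMk_eq_iff _ (t'.lift s)).2 (h1.imp fun r hr => hr.tm_cast rfl ?_)).trans
    ((homMk_eq_iff _ _).2 (h2.imp fun r hr => hr.tm_cast rfl ?_))
  · exact congrArg₂ (fun u v => Expr.id _ (.pair t.1 u) (.pair t'.1 v)) (wk_inst _ _) (wk_inst _ _)
  · exact congrArg₂ (fun u v => Expr.id _ (.pair u s.1) (.pair v s'.1)) (wk_inst _ _) (wk_inst _ _)

/-- By propositional η each arrow is the pairing of its projections, and pairing respects equality
of arrows. -/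
theorem prod_hom_ext {f g : T ⟶ prod A B} (h : f ≫ pr₁ A B = g ≫ pr₁ A B)
    (h' : f ≫ pr₂ A B = g ≫ pr₂ A B) : f = g := by
  obtain ⟨t, rfl⟩ := homMk_surjective f
  obtain ⟨s, rfl⟩ := homMk_surjective g
  rw [← pair_eta t, ← pair_eta s]
  exact lift_congr (t := t.fst) (t' := s.fst) (s := t.snd) (s' := s.snd) h h'

theorem exists_lift (f : T ⟶ A) (g : T ⟶ B) :
    ∃ v : T ⟶ prod A B, v ≫ pr₁ A B = f ∧ v ≫ pr₂ A B = g := by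
  obtain ⟨t, rfl⟩ := homMk_surjective f
  obtain ⟨s, rfl⟩ := homMk_surjective g
  exact ⟨_, lift_pr₁ t s, lift_pr₂ t s⟩

end Prod

/-- The closed collection `N₁`. -/
def one : CM := ⟨.unit, .set_col (.unit .ctx_nil)⟩

/-- Elimination on the singleton towards the proposition `Id(N₁, x, ⋆)`. -/
theorem hom_one_subsingleton (A : CM) : Subsingleton (A ⟶ one) := by
  suffices h : ∀ t : Term A one, homMk t = homMk ⟨.star, .star A.ctx_ok⟩ by
    refine ⟨fun f g => ?_⟩
    obtain ⟨t, rfl⟩ := homMk_surjective f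
    obtain ⟨s, rfl⟩ := homMk_surjective g
    rw [h t, h s]
  intro t
  have hU : Derivable A.ctx (.type .col .unit) := .set_col (.unit A.ctx_ok)
  have hc : Derivable (A.ctx.snoc .unit) .ctx := .ctx_snoc hU
  exact (homMk_eq_iff _ _).2 ⟨_, Derivable.elUnit (M := .id .unit (.var 0) .star)
    (.prop_col (.id_prop (.set_col (.unit hc)) (Derivable.var_zero hU) (.star hc))) t.2
    (.idRefl hU (.star A.ctx_ok))⟩

end CM

/-- A binary fan with existence and uniqueness of mediating arrows is a product. -/
theorem nonempty_isLimit {C : Type} [Category.{0} C] {A B V : C} (p : V ⟶ A) (q : V ⟶ B)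
    (ex : ∀ {T : C} (f : T ⟶ A) (g : T ⟶ B), ∃ v : T ⟶ V, v ≫ p = f ∧ v ≫ q = g)
    (ext : ∀ {T : C} {f g : T ⟶ V}, f ≫ p = g ≫ p → f ≫ q = g ≫ q → f = g) :
    Nonempty (IsLimit (BinaryFan.mk p q)) :=
  ⟨BinaryFan.isLimitMk (fun s => (ex s.fst s.snd).choose)
    (fun s => (ex s.fst s.snd).choose_spec.1) (fun s => (ex s.fst s.snd).choose_spec.2)
    (fun s _ h h' => ext (h.trans (ex s.fst s.snd).choose_spec.1.symm)
      (h'.trans (ex s.fst s.snd).choose_spec.2.symm))⟩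

namespace CM

/-- `A × B` is a product. -/
noncomputable def prodIsLimit (A B : CM) : IsLimit (BinaryFan.mk (pr₁ A B) (pr₂ A B)) :=
  (nonempty_isLimit _ _ exists_lift prod_hom_ext).some

instance : HasFiniteProducts CM := by
  have : HasBinaryProducts CM := @hasBinaryProducts_of_hasLimit_pair _ _
    fun {A B} => ⟨⟨_, prodIsLimit A B⟩⟩
  have (A : CM) : Nonempty (A ⟶ one) := ⟨homMk ⟨.star, .star A.ctx_ok⟩⟩
  have := hom_one_subsingleton
  have : HasTerminal CM := hasTerminal_of_unique one
  exact hasFiniteProducts_of_has_binary_and_terminal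

end CM

namespace SM

/-- The product `A × B` of closed sets. -/
def prod (A B : SM) : SM :=
  ⟨CM.prod A.obj B.obj, .sigma_set A.property (B.property.weaken_type A.obj.isCol)⟩

/-- The first projection of `A × B`. -/
def pr₁ (A B : SM) : prod A B ⟶ A := ObjectProperty.homMk (CM.pr₁ A.obj B.obj)

/-- The second projection of `A × B`. -/
def pr₂ (A B : SM) : prod A B ⟶ B := ObjectProperty.homMk (CM.pr₂ A.obj B.obj)

/-- `A × B` is a product. -/
noncomputable def prodIsLimit (A B : SM) : IsLimit (BinaryFan.mk (pr₁ A B) (pr₂ A B)) := by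
  refine (nonempty_isLimit _ _ (fun {T} f g => ?_) (fun {T f g} h h' => ?_)).some
  · obtain ⟨v, h, h'⟩ := CM.exists_lift f.hom g.hom
    exact ⟨ObjectProperty.homMk v, ObjectProperty.hom_ext _ h, ObjectProperty.hom_ext _ h'⟩
  · exact ObjectProperty.hom_ext _ (CM.prod_hom_ext (congrArg (·.hom) h) (congrArg (·.hom) h'))

instance : HasFiniteProducts SM := by
  have : HasBinaryProducts SM := @hasBinaryProducts_of_hasLimit_pair _ _
    fun {A B} => ⟨⟨_, prodIsLimit A B⟩⟩
  let U : SM := ⟨CM.one, .unit .ctx_nil⟩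
  have (A : SM) : Nonempty (A ⟶ U) :=
    ⟨ObjectProperty.homMk (CM.homMk ⟨.star, .star A.obj.ctx_ok⟩)⟩
  have (A : SM) : Subsingleton (A ⟶ U) := ⟨fun f g => ObjectProperty.hom_ext _
    ((CM.hom_one_subsingleton A.obj).elim f.hom g.hom)⟩
  have : HasTerminal SM := hasTerminal_of_unique U
  exact hasFiniteProducts_of_has_binary_and_terminal

end SM

end MTT

/-! ### Logic in the doctrines of propositions and of small propositions. -/

namespace MTT

open MTT.Expr Doctrine

/-- The term `⟨t(y), x⟩` of `A × X` in the context `y ∈ Y, x ∈ X`. -/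
theorem CM.Term.pair_wk_var {Y A : CM} (t : CM.Term Y A) (X : CM) :
    Derivable (Y.ctx.snoc X.carrier.wk) (.tm (.pair t.1.wk (.var 0))
      (((CM.prod A X).ctx.get 0).subst (fun _ => .pair t.1.wk (.var 0)))) := by
  have hX := Y.col_wk X
  have h := Derivable.pair (((A.col_wk X).weaken_up Y.isCol A.isCol).weaken_up hX (Y.col_wk A))
    (t.2.weaken_tm hX) ((Derivable.var_zero hX).tm_cast rfl (A' := Expr.inst _ t.1.wk) (by
      simp only [Expr.inst, wk_eq_subst, ren_eq_subst, subst_subst]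
      exact closed_subst _ _ _))
  refine h.tm_cast rfl ?_
  change (CM.prod A X).carrier.wk.wk = (CM.prod A X).carrier.wk.subst _
  simp only [wk_eq_subst, subst_subst]
  exact closed_subst _ _ _

/-- `col` or, if `small`, `set`. -/
def Kind.domain (small : Bool) : Kind := if small then .set else .col

namespace Pred

variable {small : Bool}

/-- The class of a predicate modulo equiprovability. -/
def cls {A : CM} (φ : Pred small A) : (doctrine small).obj (op A) :=
  toAntisymmetrization (α := Pred small A) (· ≤ ·) φ

theorem cls_surjective {A : CM} (α : (doctrine small).obj (op A)) : ∃ φ, cls φ = α :=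
  Quotient.exists_rep (s := AntisymmRel.setoid (Pred small A) (· ≤ ·)) α

theorem cls_le_iff {A : CM} {φ ψ : Pred small A} :
    cls φ ≤ cls ψ ↔ ∃ r, Derivable (A.ctx.snoc φ.1) (.tm r ψ.1.wk) := Iff.rfl

theorem cls_le_iff_imp {A : CM} {φ ψ : Pred small A} :
    cls φ ≤ cls ψ ↔ ∃ r, Derivable A.ctx (.tm r (.imp φ.1 ψ.1)) :=
  ⟨fun ⟨_, hr⟩ => ⟨_, .impLam φ.isProp ψ.isProp hr⟩, fun ⟨_, hr⟩ =>
    ⟨_, .impApp (hr.weaken_tm φ.isCol) (Derivable.var_zero φ.isCol)⟩⟩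

theorem top_le_cls_iff {A : CM} {φ : Pred small A} :
    ⊤ ≤ cls φ ↔ ∃ p, Derivable A.ctx (.tm p φ.1) := by
  refine Iff.trans (cls_le_iff_imp (φ := tt small A) (ψ := φ)) ⟨fun ⟨_, hr⟩ => ?_, fun ⟨_, hr⟩ => ?_⟩
  · have hf := Derivable.fls_prop A.ctx_ok
    exact ⟨_, .impApp hr (.impLam hf hf (Derivable.var_zero (.prop_col hf)))⟩
  · exact ⟨_, .impLam (tt small A).isProp φ.isProp (hr.weaken_tm (tt small A).isCol)⟩

theorem forces_cls_iff {A B : CM} {t : CM.Term A B} {φ : Pred small B} :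
    Forces (doctrine small) (CM.homMk t) (cls φ) ↔
      ∃ p, Derivable A.ctx (.tm p (φ.1.subst (fun _ => t.1))) :=
  top_le_cls_iff

/-! ### Comprehension -/

/-- The comprehending object is `Σ A φ`, a proposition being a collection. A proof that `t`
satisfies `φ` is the second component of the mediating term; the construction chooses such a proof.
-/
theorem isWeakComprehension {A : CM} (φ : Pred small A) :
    IsWeakComprehension (doctrine small) (cls φ) (CM.proj φ.isCol) := by
  refine ⟨top_le_cls_iff.2 ⟨_, (CM.Term.ident (CM.sigma A φ.1 φ.isCol)).snd_der⟩, fun {Y} g hg => ?_⟩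
  obtain ⟨t, rfl⟩ := CM.homMk_surjective g
  obtain ⟨p, hp⟩ := forces_cls_iff.1 hg
  exact ⟨CM.homMk (CM.Term.pair φ.isCol t p hp), CM.fst_pair t hp⟩

/-- A proof of `ψ(fst z)` for `z ∈ Σ A φ` becomes, by `of_proj`, a proof of `ψ(x)` from `x ∈ A` and
`w ∈ φ`, which is precisely the order relation. -/
theorem isFull {A : CM} (φ : Pred small A) :
    IsFull (doctrine small) (cls φ) (CM.proj φ.isCol) := by
  intro β hβ
  obtain ⟨ψ, rfl⟩ := cls_surjective β
  obtain ⟨p, hp⟩ := forces_cls_iff.1 hβ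
  refine Derivable.of_proj A.isCol φ.isCol (ψ.isProp.weaken_type φ.isCol) (hp.tm_cast rfl ?_)
  rw [Expr.subst_wk]
  exact subst_congr (fun i => Fin.cases rfl (fun i => i.elim0) i) ψ.1

/-! ### Implication and equality -/

/-- The implication `φ → ψ`. -/
def imp {A : CM} (φ ψ : Pred small A) : Pred small A :=
  ⟨.imp φ.1 ψ.1, by
    obtain ⟨φ, h⟩ := φ
    obtain ⟨ψ, h'⟩ := ψ
    cases small
    · exact .imp_prop h h'
    · exact .imp_props h h'⟩

theorem cls_le_imp {A : CM} (γ φ ψ : Pred small A) :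
    cls γ ≤ cls (imp φ ψ) ↔ cls (conj φ γ) ≤ cls ψ := by
  have hγ := γ.isCol
  have hc := (conj φ γ).isCol
  have hφ := φ.isProp.weaken_type hγ
  have hψ := ψ.isProp.weaken_type hγ
  constructor
  · intro h
    have h1 : cls (conj φ γ) ≤ cls (imp φ ψ) := le_trans (conj_le_right φ γ) h
    obtain ⟨r, hr⟩ := h1
    exact ⟨_, .impApp (B := φ.1.wk) hr (.andFst (Derivable.var_zero hc))⟩
  · intro h
    obtain ⟨r, hr⟩ := cls_le_iff_imp.1 h
    exact ⟨_, .impLam hφ hψ (.impApp (((hr.weaken_tm hγ).weaken_tm (.prop_col hφ)))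
      (.andPair (hφ.weaken_type (.prop_col hφ))
        ((γ.isProp.weaken_type hγ).weaken_type (.prop_col hφ)) (Derivable.var_zero (.prop_col hφ))
        ((Derivable.var_zero hγ).weaken_tm (.prop_col hφ))))⟩

/-- Substitution commutes with implication syntactically, so on representatives the stable
adjunction is the plain one, `cls_le_imp`, in the fibre over `Y`. -/
theorem exists_imp {A : CM} (α β : (doctrine small).obj (op A)) :
    ∃ ι : (doctrine small).obj (op A), ∀ {Y : CM} (h : Y ⟶ A) (γ : (doctrine small).obj (op Y)),
      γ ≤ pull (doctrine small) h ι ↔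
        pull (doctrine small) h α ⊓ γ ≤ pull (doctrine small) h β := by
  obtain ⟨φ, rfl⟩ := cls_surjective α
  obtain ⟨ψ, rfl⟩ := cls_surjective β
  refine ⟨cls (imp φ ψ), fun {Y} h γ => ?_⟩
  obtain ⟨t, rfl⟩ := CM.homMk_surjective h
  obtain ⟨χ, rfl⟩ := cls_surjective γ
  exact cls_le_imp χ (sub t φ) (sub t ψ)

/-- Propositional equality of two terms. -/
def eq {Y A : CM} (hA : Derivable .nil (.type (.domain small) A.carrier)) (t s : CM.Term Y A) :
    Pred small Y :=
  ⟨.id A.carrier.wk t.1 s.1, by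
    cases small
    · exact .id_prop (Y.col_wk A) t.2 s.2
    · exact .id_props (hA.weaken_type Y.isCol) t.2 s.2⟩

/-- Arrows are identified exactly when the identity proposition has a proof, so forcing that
proposition is equality of composites. In the small case `A` must be a set for the identity to be a
small proposition. -/
theorem exists_eq {Y A : CM} (hA : Derivable .nil (.type (.domain small) A.carrier))
    (f g : Y ⟶ A) : ∃ e : (doctrine small).obj (op Y), ∀ {T : CM} (h : T ⟶ Y),
      Forces (doctrine small) h e ↔ h ≫ f = h ≫ g := by
  obtain ⟨t, rfl⟩ := CM.homMk_surjective f
  obtain ⟨s, rfl⟩ := CM.homMk_surjective g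
  refine ⟨cls (eq hA t s), fun {T} h => ?_⟩
  obtain ⟨r, rfl⟩ := CM.homMk_surjective h
  rw [CM.homMk_comp, CM.homMk_comp, CM.homMk_eq_iff, forces_cls_iff]
  simp only [eq, Expr.subst, CM.wk_subst_one]
  rfl

/-! ### Quantifiers -/

section Quantifiers

variable {A X Y T : CM} (hX : Derivable .nil (.type (.domain small) X.carrier))
  (φ : Pred small (CM.prod A X))

/-- The predicate `φ(t(y), x)` in the context `y ∈ Y, x ∈ X`. -/
def body (t : CM.Term Y A) (φ : Pred small (CM.prod A X)) : Expr 2 :=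
  φ.1.subst (fun _ => .pair t.1.wk (.var 0))

theorem type_body (t : CM.Term Y A) :
    Derivable (Y.ctx.snoc X.carrier.wk) (.type (.logical small) (body t φ)) :=
  Derivable.subst (fun _ => .pair t.1.wk (.var 0)) φ.2 (.ctx_snoc (Y.col_wk X)) fun i =>
    Fin.cases (t.pair_wk_var X) (fun i => i.elim0) i

theorem logical_prop {n : ℕ} {Γ : Ctx n} {B : Expr n}
    (h : Derivable Γ (.type (.logical small) B)) : Derivable Γ (.type .prop B) := by
  cases small
  · exact h
  · exact .props_prop h

theorem body_inst (t : CM.Term Y A) (l : Expr 1) :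
    (body t φ).inst l = φ.1.subst (fun _ => .pair t.1 l) := by
  rw [body, Expr.inst, subst_subst]
  exact congrArg (fun u => φ.1.subst (fun _ => Expr.pair u l)) (wk_inst t.1 l)

theorem body_subst (t : CM.Term Y A) :
    (body (CM.Term.ident A) φ).subst (up (fun _ => t.1)) = body t φ := by
  rw [body, subst_subst]; rfl

/-- The existential quantification `∃ x ∈ X, φ(a, x)`. -/
def ex : Pred small A :=
  ⟨.ex X.carrier.wk (body (CM.Term.ident A) φ), by
    have h := type_body φ (CM.Term.ident A)
    cases small
    · exact .ex_prop (A.col_wk X) h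
    · exact .ex_props (hX.weaken_type A.isCol) h⟩

/-- The universal quantification `∀ x ∈ X, φ(a, x)`. -/
def all : Pred small A :=
  ⟨.all X.carrier.wk (body (CM.Term.ident A) φ), by
    have h := type_body φ (CM.Term.ident A)
    cases small
    · exact .all_prop (A.col_wk X) h
    · exact .all_props (hX.weaken_type A.isCol) h⟩

/-- Quantifiers commute with substitution as expressions; stability of the quantifiers rests on this
and on `sub_all`. -/
theorem sub_ex (t : CM.Term Y A) : (sub t (ex hX φ)).1 = .ex X.carrier.wk (body t φ) :=
  congrArg₂ Expr.ex (CM.wk_subst_one _ _) (body_subst φ t)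

theorem sub_all (t : CM.Term Y A) : (sub t (all hX φ)).1 = .all X.carrier.wk (body t φ) :=
  congrArg₂ Expr.all (CM.wk_subst_one _ _) (body_subst φ t)

/-- The term `⟨t(y), x⟩` in the context `(y, x) ∈ Y × X`. -/
def liftTerm (t : CM.Term Y A) : CM.Term (CM.prod Y X) (CM.prod A X) :=
  ((CM.Term.ident (CM.prod Y X)).fst.comp t).lift (CM.Term.ident (CM.prod Y X)).snd

/-- Replaces the abstract arrow `t × id` of the criterion `IsFirstOrder.of_products` by a concrete
term. -/
theorem homMk_liftTerm (t : CM.Term Y A) (v : CM.prod Y X ⟶ CM.prod A X)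
    (h : v ≫ CM.pr₁ A X = CM.pr₁ Y X ≫ CM.homMk t) (h' : v ≫ CM.pr₂ A X = CM.pr₂ Y X) :
    v = CM.homMk (liftTerm t) :=
  CM.prod_hom_ext (h.trans (CM.lift_pr₁ _ _).symm) (h'.trans (CM.lift_pr₂ _ _).symm)

/-- Relates the two presentations of a predicate on `Y × X`: over the context of two variables, and
over one variable in the sum. It puts predicates into the form that `of_proj` expects. -/
theorem body_fst_snd (t : CM.Term Y A) :
    (body t φ).subst (scons (Expr.snd (.var 0)) (scons (Expr.fst (.var 0)) (fun i => .var i.succ))) =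
      (sub (liftTerm (X := X) t) φ).1 := by
  rw [body, subst_subst]
  refine congrArg (fun u => φ.1.subst (fun _ => Expr.pair u (Expr.snd (.var 0)))) ?_
  rw [Expr.subst_wk]
  exact subst_congr (fun i => Fin.cases rfl (fun i => i.elim0) i) t.1

theorem forces_ex {v : T ⟶ CM.prod A X} (h : Forces (doctrine small) v (cls φ)) :
    Forces (doctrine small) (v ≫ CM.pr₁ A X) (cls (ex hX φ)) := by
  obtain ⟨d, rfl⟩ := CM.homMk_surjective v
  -- By η the element is a literal pair, so its second component serves as witness and the proof has
  -- the form of an instance of `body`.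
  rw [← CM.pair_eta d] at h
  obtain ⟨p, hp⟩ := forces_cls_iff.1 h
  refine forces_cls_iff (t := d.fst).2 ⟨_, (Derivable.exPair (b := Expr.snd d.1) (c := p)
    (logical_prop (type_body φ d.fst)) d.snd.2 ?_).tm_cast rfl (sub_ex hX φ d.fst).symm⟩
  exact hp.tm_cast rfl (body_inst φ d.fst _).symm

theorem of_forces_all {v : T ⟶ CM.prod A X}
    (h : Forces (doctrine small) (v ≫ CM.pr₁ A X) (cls (all hX φ))) :
    Forces (doctrine small) v (cls φ) := by
  obtain ⟨d, rfl⟩ := CM.homMk_surjective v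
  obtain ⟨p, hp⟩ := (forces_cls_iff (t := d.fst)).1 h
  rw [← CM.pair_eta d]
  exact forces_cls_iff.2 ⟨_, (Derivable.allApp (hp.tm_cast rfl (sub_all hX φ d.fst))
    d.snd.2).tm_cast rfl (body_inst φ d.fst _)⟩

/-- `of_proj` turns the implication over `Y × X` into one over `y ∈ Y, x ∈ X`, to which
∃-elimination applies. -/
theorem pull_ex_le (t : CM.Term Y A) (γ : Pred small Y)
    (h : cls (sub (liftTerm t) φ) ≤ pull (doctrine small) (CM.pr₁ Y X) (cls γ)) :
    cls (sub t (ex hX φ)) ≤ cls γ := by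
  obtain ⟨r, hr⟩ := cls_le_iff_imp (ψ := sub (CM.Term.ident _).fst γ).1 h
  have hb := logical_prop (type_body φ t)
  obtain ⟨q, hq⟩ := Derivable.of_proj (χ := .imp (body t φ) γ.1.wk) Y.isCol (Y.col_wk X)
    (.imp_prop hb (γ.isProp.weaken_type (Y.col_wk X))) (hr.tm_cast rfl
      (congrArg₂ Expr.imp (body_fst_snd φ t).symm (by
        rw [Expr.subst_wk]
        exact subst_congr (fun i => Fin.cases rfl (fun i => i.elim0) i) γ.1)))
  rw [cls_le_iff, sub_ex]
  exact ⟨_, (Derivable.ex_le (Y.col_wk X) hb γ.isProp hq).choose_spec⟩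

theorem forces_all (t : CM.Term Y A)
    (h : Forces (doctrine small) (CM.homMk (liftTerm t)) (cls φ)) :
    Forces (doctrine small) (CM.homMk t) (cls (all hX φ)) := by
  obtain ⟨r, hr⟩ := forces_cls_iff.1 h
  have hb := logical_prop (type_body φ t)
  obtain ⟨q, hq⟩ := Derivable.of_proj Y.isCol (Y.col_wk X) hb
    (hr.tm_cast rfl (body_fst_snd φ t).symm)
  exact forces_cls_iff.2 ⟨_, (Derivable.allLam hb hq).tm_cast rfl (sub_all hX φ t).symm⟩

end Quantifiers

end Pred

/-! ### The doctrines are first-order -/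

theorem F_isFirstOrder : IsFirstOrder F := by
  refine .of_products (fun A α => ?_) Pred.exists_imp
    (fun {Y A} f g => Pred.exists_eq (small := false) A.isCol f g) CM.prodIsLimit
    (fun {A X} α => ?_) (fun {A X} α => ?_)
  · obtain ⟨φ, rfl⟩ := Pred.cls_surjective α
    exact ⟨_, _, Pred.isWeakComprehension φ, Pred.isFull φ⟩
  · obtain ⟨φ, rfl⟩ := Pred.cls_surjective α
    refine ⟨Pred.cls (Pred.ex X.isCol φ), fun v => Pred.forces_ex (small := false) X.isCol φ,
      fun {Y} h v γ hv hv' H => ?_⟩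
    obtain ⟨t, rfl⟩ := CM.homMk_surjective h
    obtain ⟨ψ, rfl⟩ := Pred.cls_surjective γ
    rw [Pred.homMk_liftTerm t v hv hv'] at H
    exact Pred.pull_ex_le (small := false) X.isCol φ t ψ H
  · obtain ⟨φ, rfl⟩ := Pred.cls_surjective α
    refine ⟨Pred.cls (Pred.all X.isCol φ), fun v => Pred.of_forces_all (small := false) X.isCol φ,
      fun {Y} h v hv hv' H => ?_⟩
    obtain ⟨t, rfl⟩ := CM.homMk_surjective h
    rw [Pred.homMk_liftTerm t v hv hv'] at H
    exact Pred.forces_all (small := false) X.isCol φ t H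

/-- `SM` is a full subcategory, and the constructions remain in it: `Σ A φ` is a set because a small
proposition is one, and equality and quantification over sets keep propositions small. -/
theorem G_isFirstOrder : IsFirstOrder G := by
  refine .of_products (fun A α => ?_) (fun {A} α β => ?_) (fun {Y A} f g => ?_) SM.prodIsLimit
    (fun {A X} α => ?_) (fun {A X} α => ?_)
  · obtain ⟨φ, rfl⟩ := Pred.cls_surjective (small := true) (A := A.obj) α
    refine ⟨⟨CM.sigma A.obj φ.1 φ.isCol, .sigma_set A.property (.props_set φ.2)⟩,
      ObjectProperty.homMk (CM.proj φ.isCol), ⟨(Pred.isWeakComprehension φ).1, fun {Y} g hg => ?_⟩,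
      fun β hβ => Pred.isFull φ β hβ⟩
    obtain ⟨h, hh⟩ := (Pred.isWeakComprehension φ).2 g.hom hg
    exact ⟨ObjectProperty.homMk h, ObjectProperty.hom_ext _ hh⟩
  · obtain ⟨ι, hι⟩ := Pred.exists_imp (small := true) (A := A.obj) α β
    exact ⟨ι, fun h γ => hι h.hom γ⟩
  · obtain ⟨e, he⟩ := Pred.exists_eq (small := true) A.property f.hom g.hom
    exact ⟨e, fun h => (he h.hom).trans ⟨fun H => ObjectProperty.hom_ext _ H,
      fun H => congrArg (·.hom) H⟩⟩
  · obtain ⟨φ, rfl⟩ := Pred.cls_surjective (small := true) (A := CM.prod A.obj X.obj) α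
    refine ⟨Pred.cls (Pred.ex X.property φ), fun v => Pred.forces_ex (small := true) (v := v.hom) X.property φ,
      fun {Y} h v γ hv hv' H => ?_⟩
    obtain ⟨t, ht⟩ := CM.homMk_surjective h.hom
    obtain ⟨ψ, rfl⟩ := Pred.cls_surjective (small := true) (A := Y.obj) γ
    have hv₁ := Pred.homMk_liftTerm t v.hom (ht ▸ congrArg (·.hom) hv) (congrArg (·.hom) hv')
    -- The fibres and substitutions of `G` are those of the doctrine on `CM`, so the rules proved
    -- there apply to underlying arrows.
    change pull (Pred.doctrine true) v.hom (Pred.cls φ) ≤ _ at H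
    change pull (Pred.doctrine true) h.hom (Pred.cls (Pred.ex X.property φ)) ≤ Pred.cls ψ
    rw [hv₁] at H
    rw [← ht]
    exact Pred.pull_ex_le (small := true) X.property φ t ψ H
  · obtain ⟨φ, rfl⟩ := Pred.cls_surjective (small := true) (A := CM.prod A.obj X.obj) α
    refine ⟨Pred.cls (Pred.all X.property φ),
      fun v => Pred.of_forces_all (small := true) (v := v.hom) X.property φ, fun {Y} h v hv hv' H => ?_⟩
    obtain ⟨t, ht⟩ := CM.homMk_surjective h.hom
    have hv₁ := Pred.homMk_liftTerm t v.hom (ht ▸ congrArg (·.hom) hv) (congrArg (·.hom) hv')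
    change Forces (Pred.doctrine true) v.hom (Pred.cls φ) at H
    change Forces (Pred.doctrine true) h.hom (Pred.cls (Pred.all X.property φ))
    rw [hv₁] at H
    rw [← ht]
    exact Pred.forces_all (small := true) X.property φ t H

end MTT

/-! ### Weak exponentials of closed sets from dependent products. -/

namespace MTT

open MTT.Expr

namespace SM

/-- The closed set `A → B`. -/
def fn (A B : SM) : SM :=
  have h := Derivable.pi A.property (B.property.weaken_type A.obj.isCol)
  ⟨⟨.pi A.obj.carrier B.obj.carrier.wk, .set_col h⟩, h⟩

section Exponential

variable {A B : SM} {T : CM}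

/-- Application of a term of `A → B`. -/
def app (d : CM.Term T (fn A B).obj) (a : CM.Term T A.obj) : CM.Term T B.obj :=
  ⟨.app d.1 a.1,
    (Derivable.app (C := B.obj.carrier.wk.ren (upr Fin.succ)) d.2 a.2).tm_cast rfl (by
      simp only [Expr.inst, wk_eq_subst, ren_eq_subst, subst_subst]
      exact closed_subst _ _ _)⟩

theorem app_congr {d d' : CM.Term T (fn A B).obj} {a a' : CM.Term T A.obj}
    (h : CM.homMk d = CM.homMk d') (h' : CM.homMk a = CM.homMk a') :
    CM.homMk (app d a) = CM.homMk (app d' a') := by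
  rw [CM.homMk_eq_iff] at h h'
  obtain ⟨p, hp⟩ := h
  obtain ⟨p', hp'⟩ := h'
  have hF := T.col_wk (fn A B).obj
  have hA := T.col_wk A.obj
  have hB := T.col_wk B.obj
  have e : ∀ (u : Expr 2), ((B.obj.carrier.wk.ren (upr Fin.succ)).ren (upr Fin.succ)).inst u =
      (B.obj.carrier.wk.wk : Expr 2) := fun u => by
    simp only [Expr.inst, wk_eq_subst, ren_eq_subst, subst_subst]
    exact closed_subst _ _ _
  have h1 := Derivable.id_congr (e := .app (.var 0) a.1.wk) T.ctx_ok hF hB d.2 d'.2 hp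
    ((Derivable.app (Derivable.var_zero hF) (a.2.weaken_tm hF)).tm_cast rfl (e _))
  have h2 := Derivable.id_congr (e := .app d'.1.wk (.var 0)) T.ctx_ok hA hB a.2 a'.2 hp'
    ((Derivable.app (d'.2.weaken_tm hA) (Derivable.var_zero hA)).tm_cast rfl (e _))
  refine ((CM.homMk_eq_iff _ (app d' a)).2 (h1.imp fun r hr => hr.tm_cast rfl ?_)).trans
    ((CM.homMk_eq_iff _ _).2 (h2.imp fun r hr => hr.tm_cast rfl ?_))
  · exact congrArg₂ (fun u v => Expr.id _ (.app d.1 u) (.app d'.1 v)) (wk_inst _ _) (wk_inst _ _)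
  · exact congrArg₂ (fun u v => Expr.id _ (.app u a.1) (.app v a'.1)) (wk_inst _ _) (wk_inst _ _)

variable {X : CM}

theorem curry_body (f : CM.Term (CM.prod X A.obj) B.obj) (t : CM.Term T X) :
    Derivable (T.ctx.snoc A.obj.carrier.wk)
      (.tm (f.1.subst (fun _ => .pair t.1.wk (.var 0))) B.obj.carrier.wk.wk) :=
  (Derivable.subst (fun _ => .pair t.1.wk (.var 0)) f.2 (.ctx_snoc (T.col_wk A.obj)) fun i =>
    Fin.cases (t.pair_wk_var A.obj) (fun i => i.elim0) i).tm_cast rfl (by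
      simp only [wk_eq_subst, subst_subst]
      exact closed_subst _ _ _)

/-- The term `λ a. f(t(x), a)`. -/
def curry (f : CM.Term (CM.prod X A.obj) B.obj) (t : CM.Term T X) : CM.Term T (fn A B).obj :=
  ⟨.lam A.obj.carrier.wk (f.1.subst (fun _ => .pair t.1.wk (.var 0))),
    (Derivable.lam (A.property.weaken_type T.isCol)
      ((B.property.weaken_type T.isCol).weaken_type (T.col_wk A.obj)) (curry_body f t)).tm_cast rfl
      (congrArg (Expr.pi _) (by
        simp only [wk_eq_subst, ren_eq_subst, subst_subst]
        exact closed_subst _ _ _))⟩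

/-- Naturality of abstraction holds as an identity of expressions, since substitution passes under
the binder; no ξ-rule is used. -/
theorem curry_comp (f : CM.Term (CM.prod X A.obj) B.obj) (t : CM.Term T X) :
    t.comp (curry f (CM.Term.ident X)) = curry f t := by
  refine CM.Term.ext (congrArg₂ Expr.lam (CM.wk_subst_one _ _) ?_)
  rw [subst_subst]; rfl

theorem app_curry (f : CM.Term (CM.prod X A.obj) B.obj) (t : CM.Term T X) (a : CM.Term T A.obj) :
    CM.homMk (app (curry f t) a) = CM.homMk (t.lift a) ≫ CM.homMk f := by
  refine CM.homMk_eq ((Derivable.app_lam (A.property.weaken_type T.isCol)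
      ((B.property.weaken_type T.isCol).weaken_type (T.col_wk A.obj)) (curry_body f t) a.2).cast ?_)
  rw [wk_inst]
  refine congrArg (Judgment.tmEq (app (curry f t) a).1 · B.obj.carrier.wk) ?_
  rw [Expr.inst, subst_subst]
  exact congrArg (fun u => f.1.subst (fun _ => Expr.pair u a.1)) (wk_inst _ _)

end Exponential

/-- The transpose of `f` is the abstraction of a chosen representative `t`. Without a ξ-rule,
independence of this choice is not available, and a weak exponential does not require it. -/
theorem weaklyCartesianClosed : Doctrine.WeaklyCartesianClosed SM := by
  refine Doctrine.weaklyCartesianClosed_of_isLimit prod pr₁ pr₂ prodIsLimit fun A B =>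
    ⟨fn A B, ObjectProperty.homMk (CM.homMk
      (app (CM.Term.ident (CM.prod (fn A B).obj A.obj)).fst (CM.Term.ident _).snd)),
      fun {X} f => ?_⟩
  obtain ⟨t, ht⟩ : ∃ t : CM.Term (CM.prod X.obj A.obj) B.obj, CM.homMk t = f.hom :=
    CM.homMk_surjective f.hom
  refine ⟨ObjectProperty.homMk (CM.homMk (curry t (CM.Term.ident _))), fun v hv hv' =>
    ObjectProperty.hom_ext _ ?_⟩
  obtain ⟨d, hd⟩ : ∃ d : CM.Term (CM.prod X.obj A.obj) (CM.prod (fn A B).obj A.obj),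
      CM.homMk d = v.hom := CM.homMk_surjective v.hom
  have h : CM.homMk d.fst = CM.homMk (curry t (CM.Term.ident (CM.prod X.obj A.obj)).fst) := by
    rw [← curry_comp]
    refine Eq.trans ?_ (congrArg (·.hom) hv)
    exact congrArg (· ≫ CM.pr₁ (fn A B).obj A.obj) hd
  have h' : CM.homMk d.snd = CM.homMk (CM.Term.ident (CM.prod X.obj A.obj)).snd :=
    (congrArg (· ≫ CM.pr₂ (fn A B).obj A.obj) hd).trans (congrArg (·.hom) hv')
  have h₁ : CM.homMk (app d.fst d.snd) = CM.homMk t := by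
    -- β reduces the evaluation to `t` at the pair of the two projections, and that pair is the
    -- identity by η.
    rw [app_congr h h', app_curry]
    refine (congrArg (· ≫ CM.homMk t) (CM.pair_eta (CM.Term.ident (CM.prod X.obj A.obj)))).trans ?_
    exact Category.id_comp (CM.homMk t)
  exact (ht.symm.trans h₁.symm).trans (congrArg (· ≫ CM.homMk
    (app (CM.Term.ident (CM.prod (fn A B).obj A.obj)).fst (CM.Term.ident _).snd)) hd)

end SM

end MTT

/-- The two doctrines of the minimal type theory: their base categories have finite products, both
are elementary, existential, implicational and universal, with full weak comprehensions and
comprehensive weak equalizers, and the base of the second one is weakly cartesian closed. -/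
theorem proposition7p5 :
    ∃ (_ : HasFiniteProducts MTT.CM) (_ : HasFiniteProducts MTT.SM),
      (Doctrine.IsElementary MTT.F ∧ Doctrine.IsExistential MTT.F ∧
        Doctrine.IsImplicational MTT.F ∧ Doctrine.IsUniversal MTT.F ∧
        Doctrine.HasFullWeakComprehensions MTT.F ∧
        Doctrine.HasComprehensiveWeakEqualizers MTT.F) ∧
      (Doctrine.IsElementary MTT.G ∧ Doctrine.IsExistential MTT.G ∧
        Doctrine.IsImplicational MTT.G ∧ Doctrine.IsUniversal MTT.G ∧
        Doctrine.HasFullWeakComprehensions MTT.G ∧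
        Doctrine.HasComprehensiveWeakEqualizers MTT.G) ∧
      Doctrine.WeaklyCartesianClosed MTT.SM :=
  have hF := MTT.F_isFirstOrder
  have hG := MTT.G_isFirstOrder
  ⟨inferInstance, inferInstance,
    ⟨hF.isElementary, hF.isExistential, hF.isImplicational, hF.isUniversal, hF.comprehension,
      hF.hasComprehensiveWeakEqualizers⟩,
    ⟨hG.isElementary, hG.isExistential, hG.isImplicational, hG.isUniversal, hG.comprehension,
      hG.hasComprehensiveWeakEqualizers⟩, MTT.SM.weaklyCartesianClosed⟩
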